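/- Let $n\ge 2$ and let $\Omega_0,\Omega_1\subset\mathbb{R}^n$ be bounded domains (nonempty, open, connected) with $\overline{\Omega}_1\subset\Omega_0$; put $\Omega=\Omega_0\setminus\overline{\Omega}_1$. Assume that $\partial\Omega_0$ and $\partial\Omega_1$ are of class $C^2$ (each $\Omega_i$ is, near every point of its boundary, of the form $\{\rho<0\}$ with $\rho$ of class $C^2$, and $\rho=0$, $D\rho\neq0$ at that point) and strictly convex, i.e. whenever $x\ne y$ are points of $\overline{\Omega}_i$, the open segment between them lies in the interior of $\overline{\Omega}_i$. Let $u\in C^1(\overline{\Omega})$, i.e. $u$ is $C^1$ in $\Omega$, and $u$ and $Du$ extend continuously to $\overline{\Omega}$, and suppose that $$\Delta u=0\ \text{ in }\Omega,\qquad u=0\ \text{ on }\partial\Omega_0,\qquad u=1\ \text{ on }\partial\Omega_1,$$ and that $Du$ vanishes nowhere in $\Omega$. For $x\in\overline{\Omega}$ let $\kappa_1(x)$ be the smallest principal curvature at $x$ of the level set of $u$ through $x$. Principal curvatures are the eigenvalues, on the tangent space, of the differential of the unit normal pointing out of the region enclosed by the level set, that is, in the direction in which $u$ decreases (so round spheres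 have positive curvatures). The level sets $\{u=0\}$ and $\{u=1\}$ are $\partial\Omega_0$ and $\partial\Omega_1$, whose unit normals point out of $\Omega_0$ and $\Omega_1$. Write $Du$ on $\partial\Omega$ for the continuous extension of $Du$ from $\Omega$. Then $|Du|\,\kappa_1$ attains its minimum over $\overline{\Omega}$ on $\partial\Omega$: there is $p\in\partial\Omega$ such that $$|Du(p)|\,\kappa_1(p)\le|Du(x)|\,\kappa_1(x)\qquad\text{for all }x\in\overline{\Omega}.$$ -/

import Mathlib

open Set Filter Topology

noncomputable section

/-- `ρ` is a `C²` local defining function of the set `D` at the point `p` of its boundary: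
near `p` the set `D` is `{ρ < 0}`, with `ρ p = 0` and `∇ρ(p) ≠ 0`. -/
structure IsC2DefiningFunction {n : ℕ} (ρ : EuclideanSpace ℝ (Fin n) → ℝ)
    (D : Set (EuclideanSpace ℝ (Fin n))) (p : EuclideanSpace ℝ (Fin n)) : Prop where
  contDiffAt : ContDiffAt ℝ 2 ρ p
  eq_zero : ρ p = 0
  gradient_ne_zero : gradient ρ p ≠ 0
  mem_iff : ∀ᶠ y in 𝓝 p, y ∈ D ↔ ρ y < 0

/-- The boundary of `D` is of class `C²` (with `D` locally on one side of it). -/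
def HasC2Boundary {n : ℕ} (D : Set (EuclideanSpace ℝ (Fin n))) : Prop :=
  ∀ p ∈ frontier D, ∃ ρ, IsC2DefiningFunction ρ D p

/-- The unit normal field `∇ρ / |∇ρ|` of the level sets of `ρ`; it points out of `{ρ < 0}`. -/
def unitNormal {n : ℕ} (ρ : EuclideanSpace ℝ (Fin n) → ℝ) (x : EuclideanSpace ℝ (Fin n)) :
    EuclideanSpace ℝ (Fin n) :=
  ‖gradient ρ x‖⁻¹ • gradient ρ x

/-- The principal curvatures at `p` of the hypersurface `∂D`: the eigenvalues, on the tangent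
space `∇ρ(p)ᗮ`, of the shape operator `v ↦ D_v N`, where `N` is the unit normal pointing out of
`D`. They do not depend on the local defining function `ρ`. With this sign the sphere bounding a
ball of radius `r` has all its principal curvatures equal to `1 / r`. -/
def principalCurvatures {n : ℕ} (D : Set (EuclideanSpace ℝ (Fin n)))
    (p : EuclideanSpace ℝ (Fin n)) : Set ℝ :=
  {k | ∃ ρ, IsC2DefiningFunction ρ D p ∧
    ∃ v, v ≠ 0 ∧ inner ℝ (gradient ρ p) v = 0 ∧ fderiv ℝ (unitNormal ρ) p v = k • v}

/-- The smallest principal curvature at `p` of the hypersurface `∂D`. (Where `∂D` is `C²` near `p`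
and `n ≥ 2`, the set of principal curvatures is finite and nonempty, so this is its minimum.) -/
def smallestPrincipalCurvature {n : ℕ} (D : Set (EuclideanSpace ℝ (Fin n)))
    (p : EuclideanSpace ℝ (Fin n)) : ℝ :=
  sInf (principalCurvatures D p)

/-- The ring `Ω₀ \ closure Ω₁`. -/
def ringDomain {n : ℕ} (Ω₀ Ω₁ : Set (EuclideanSpace ℝ (Fin n))) :
    Set (EuclideanSpace ℝ (Fin n)) :=
  Ω₀ \ closure Ω₁

/-- The region enclosed by the level set `{u = c}`, namely `{u > c}` with the hole `Ω₁` filled in.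
For `u = 0` on `∂Ω₀`, `u = 1` on `∂Ω₁` and `0 < u < 1` between, it is `Ω₀` when `c = 0` and `Ω₁`
when `c = 1`, so the level sets of the two boundary values are `∂Ω₀` and `∂Ω₁` themselves. -/
def enclosedRegion {n : ℕ} (Ω₀ Ω₁ : Set (EuclideanSpace ℝ (Fin n)))
    (u : EuclideanSpace ℝ (Fin n) → ℝ) (c : ℝ) : Set (EuclideanSpace ℝ (Fin n)) :=
  Ω₁ ∪ {y | y ∈ closure (ringDomain Ω₀ Ω₁) ∧ c < u y}

/-- `κ₁(x)`: the smallest principal curvature at `x` of the level set of `u` through `x`. -/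
def kappaOne {n : ℕ} (Ω₀ Ω₁ : Set (EuclideanSpace ℝ (Fin n)))
    (u : EuclideanSpace ℝ (Fin n) → ℝ) (x : EuclideanSpace ℝ (Fin n)) : ℝ :=
  smallestPrincipalCurvature (enclosedRegion Ω₀ Ω₁ u (u x)) x

/-- `u ∈ C¹(closure Ω)` for an open set `Ω`: `u` is continuous on `closure Ω` and `C¹` in `Ω`, and
its gradient extends continuously to `closure Ω`. -/
structure IsC1UpToBoundary {n : ℕ} (u : EuclideanSpace ℝ (Fin n) → ℝ)
    (Ω : Set (EuclideanSpace ℝ (Fin n))) : Prop where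
  continuousOn : ContinuousOn u (closure Ω)
  contDiffOn : ContDiffOn ℝ 1 u Ω
  exists_extension : ∃ G : EuclideanSpace ℝ (Fin n) → EuclideanSpace ℝ (Fin n),
    ContinuousOn G (closure Ω) ∧ EqOn G (gradient u) Ω

/-- `Du` on `closure Ω`: the extension by continuity of the gradient of `u` in `Ω`. -/
def closedGradient {n : ℕ} (u : EuclideanSpace ℝ (Fin n) → ℝ)
    (Ω : Set (EuclideanSpace ℝ (Fin n))) :
    EuclideanSpace ℝ (Fin n) → EuclideanSpace ℝ (Fin n) :=
  extendFrom Ω (gradient u)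

end

/-!
Write `U` for `u` continued by `1` over the hole. At an interior point `|Du| κ₁` is the minimum of
`-D²u(v, v)` over unit vectors `v` orthogonal to `Du`, so a lower bound `c` for it means
`D²u(v, v) ≤ -c |v|²` on the tangent spaces of the level sets. Such a bound follows from a midpoint
inequality
`U ((x + y) / 2) ≥ min (U x) (U y) + T (x - y)`
in which `T` is nonnegative and `T w ≈ c |w|² / 8` at the origin, and this two-point inequality is
proved by a maximum principle that uses no regularity of `u` at the boundary beyond `C¹`.

For `T = 0` this is Gabriel's theorem on the convexity of the level sets
(`IsRingPotential.min_le_midpoint`). At a negative interior minimum of the difference of the two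
sides the gradients at `x`, `y` and the midpoint are parallel, and moving `x` and `y` in the same
direction at rates inverse to the gradients, then averaging over directions, contradicts
harmonicity once `U` at the midpoint is made strictly superharmonic.

For `c > 0` take `T w = (c / 4) (r √(|w|² + r²) - r²)`, which is convex, has the right Hessian at the
origin for every `r`, and tends to zero uniformly on bounded sets as `r → 0`. At an interior minimum
(`IsRingPotential.not_local_min_penalized`) the gradients `P = Du(x)` and `R = Du(y)` are no longer
parallel. In the plane they span one varies `x` and `y` by the complex multiples of the inversions
`P / |P|²` and `R / |R|²`; on the orthogonal complement by the factors `1 / |P|` and `1 / |R|`. These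
variations are conformal on each piece, so harmonicity removes the Hessians at `x` and `y`, and the
mismatch at the midpoint is a nonnegative multiple of the trace of `D²u` over directions tangent to
the level set, which is nonpositive by Gabriel's theorem. Convexity of `T` gives the contradiction
(`false_of_independent_second_order`).

The remaining configurations have an endpoint on the outer boundary or the midpoint on the inner
one. Away from the diagonal, strict convexity gives a positive gap, which exceeds `T` for small `r`.
Near the diagonal, the inequality follows from `c < |Du| κ₁` on the boundary: `ρ + M ρ²` is a
strongly convex defining function (`IsC2DefiningFunction.exists_strongly_convex`), and `u` is
compared with it by following the gradient to the boundary (`eventually_mul_abs_le`).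

On each boundary component `|Du| κ₁` is lower semicontinuous, hence attains its minimum
(`HasC2Boundary.exists_forall_mul_le`). If the smaller `m` of the two minima is nonpositive, Gabriel's
theorem suffices; otherwise the penalized inequality is used with every `c` in `(0, m)`.
-/

/-! ### Second-order expansions along curves -/

/-- The second differential of `f` at `x`, as a bilinear form. -/
noncomputable abbrev hess {E : Type*} [NormedAddCommGroup E] [NormedSpace ℝ E] (f : E → ℝ) (x : E) :
    E →L[ℝ] E →L[ℝ] ℝ :=
  fderiv ℝ (fderiv ℝ f) x

/-- `g t = a + b t + c t² / 2 + o(t²)` as `t → 0`; thus `c` plays the role of `g''(0)`. -/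
def HasSecondOrderExpansion (g : ℝ → ℝ) (a b c : ℝ) : Prop :=
  (fun t => g t - (a + b * t + c / 2 * t ^ 2)) =o[𝓝 0] fun t : ℝ => t ^ 2

namespace HasSecondOrderExpansion

variable {g h : ℝ → ℝ} {a b c a' b' c' : ℝ}

lemma add (hg : HasSecondOrderExpansion g a b c) (hh : HasSecondOrderExpansion h a' b' c') :
    HasSecondOrderExpansion (fun t => g t + h t) (a + a') (b + b') (c + c') :=
  (Asymptotics.IsLittleO.add hg hh).congr_left fun t => by ring

lemma const_mul (k : ℝ) (hg : HasSecondOrderExpansion g a b c) :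
    HasSecondOrderExpansion (fun t => k * g t) (k * a) (k * b) (k * c) :=
  (Asymptotics.IsLittleO.const_mul_left hg k).congr_left fun t => by ring

lemma sub (hg : HasSecondOrderExpansion g a b c) (hh : HasSecondOrderExpansion h a' b' c') :
    HasSecondOrderExpansion (fun t => g t - h t) (a - a') (b - b') (c - c') :=
  (Asymptotics.IsLittleO.sub hg hh).congr_left fun t => by ring

lemma eventually_lt (hg : HasSecondOrderExpansion g a 0 c) (hc : c < 0) :
    ∀ᶠ t in 𝓝[≠] (0 : ℝ), g t < a := by
  have h := (Asymptotics.isLittleO_iff.1 hg) (show (0 : ℝ) < -c / 4 by linarith)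
  filter_upwards [nhdsWithin_le_nhds h, self_mem_nhdsWithin] with t ht ht0
  have h2 : 0 < t ^ 2 := by
    have : t ≠ 0 := ht0
    positivity
  rw [Real.norm_eq_abs, Real.norm_eq_abs, abs_of_pos h2] at ht
  have := (abs_le.1 ht).2
  nlinarith

lemma eventually_gt (hg : HasSecondOrderExpansion g a 0 c) (hc : 0 < c) :
    ∀ᶠ t in 𝓝[≠] (0 : ℝ), a < g t := by
  have := (hg.const_mul (-1))
  rw [mul_zero] at this
  filter_upwards [this.eventually_lt (by linarith)] with t ht
  linarith

lemma eventually_lt_of_neg (hg : HasSecondOrderExpansion g a b c) (hb : b < 0) :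
    ∀ᶠ t in 𝓝[>] (0 : ℝ), g t < a := by
  have h := (Asymptotics.isLittleO_iff.1 hg) (show (0 : ℝ) < 1 by norm_num)
  have h' : ∀ᶠ t in 𝓝 (0 : ℝ), b + (c / 2 + 1) * t < 0 := by
    refine ContinuousAt.eventually_lt (by fun_prop) continuousAt_const ?_
    simpa using hb
  filter_upwards [nhdsWithin_le_nhds h, nhdsWithin_le_nhds h', self_mem_nhdsWithin]
    with t ht ht' ht0
  have ht0 : 0 < t := ht0
  have h2 : 0 < t ^ 2 := by positivity
  rw [Real.norm_eq_abs, Real.norm_eq_abs, abs_of_pos h2] at ht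
  have := (abs_le.1 ht).2
  nlinarith

lemma of_hasDerivAt {g' : ℝ → ℝ} (hg : ∀ᶠ t in 𝓝 0, HasDerivAt g (g' t) t)
    (hg' : HasDerivAt g' c 0) : HasSecondOrderExpansion g (g 0) (g' 0) c := by
  obtain ⟨ε, hε, hball⟩ := Metric.eventually_nhds_iff_ball.1 hg
  have hnhds : 𝓝[Metric.ball (0 : ℝ) ε] 0 = 𝓝 0 :=
    Metric.isOpen_ball.nhdsWithin_eq (Metric.mem_ball_self hε)
  have key := (convex_ball (0 : ℝ) ε).isLittleO_pow_succ_real (n := 1)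
    (f := fun t => g t - (g' 0 * t + c / 2 * t ^ 2)) (f' := fun t => g' t - (g' 0 + c * t))
    (Metric.mem_ball_self hε) (fun t ht => by
      have h1 : HasDerivAt (fun t => g t - (g' 0 * t + c / 2 * t ^ 2))
          (g' t - (g' 0 * 1 + c / 2 * (2 * t))) t := by
        refine (hball t ht).sub (((hasDerivAt_id t).const_mul _).add ?_)
        simpa using (hasDerivAt_pow 2 t).const_mul (c / 2)
      convert! h1.hasDerivWithinAt using 1
      ring) (by
      rw [hnhds]
      have := hasDerivAt_iff_isLittleO.1 hg'
      refine (this.congr_left fun t => ?_).congr_right fun t => ?_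
      · simp only [sub_zero, smul_eq_mul]; ring
      · simp)
  rw [hnhds] at key
  refine (key.congr_left fun t => ?_).congr_right fun t => ?_
  · simp only [mul_zero]; ring
  · simp

end HasSecondOrderExpansion

section

variable {E : Type*} [NormedAddCommGroup E] [NormedSpace ℝ E] {f : E → ℝ} {x : E}

lemma ContDiffAt.eventually_differentiableAt_two (hf : ContDiffAt ℝ 2 f x) :
    ∀ᶠ y in 𝓝 x, DifferentiableAt ℝ f y := by
  filter_upwards [hf.eventually (by simp)] with y hy
  exact hy.differentiableAt (by simp)

lemma ContDiffAt.hasFDerivAt_fderiv (hf : ContDiffAt ℝ 2 f x) :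
    HasFDerivAt (fderiv ℝ f) (hess f x) x :=
  ((hf.fderiv_right (m := 1) (by norm_num)).differentiableAt (by simp)).hasFDerivAt

lemma ContDiffAt.continuousAt_hess (hf : ContDiffAt ℝ 2 f x) : ContinuousAt (hess f) x :=
  ((hf.fderiv_right (m := 1) (by norm_num)).fderiv_right (m := 0) (by norm_num)).continuousAt

lemma hess_comm (hf : ContDiffAt ℝ 2 f x) (v w : E) : hess f x v w = hess f x w v :=
  (hf.isSymmSndFDerivAt (by simp)) v w

/-- Second-order Taylor expansion of `f` along the parabola `t ↦ x + t v + t² p`. -/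
lemma ContDiffAt.hasSecondOrderExpansion (hf : ContDiffAt ℝ 2 f x) (v p : E) :
    HasSecondOrderExpansion (fun t => f (x + t • v + t ^ 2 • p)) (f x) (fderiv ℝ f x v)
      (hess f x v v + 2 * fderiv ℝ f x p) := by
  set γ : ℝ → E := fun t => x + t • v + t ^ 2 • p with hγ
  have hγ' : ∀ t, HasDerivAt γ (v + (2 * t) • p) t := fun t => by
    have h1 : HasDerivAt (fun t : ℝ => t • v) ((1 : ℝ) • v) t := (hasDerivAt_id t).smul_const v
    have h2 : HasDerivAt (fun t : ℝ => t ^ 2 • p) ((2 * t) • p) t := by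
      simpa using (hasDerivAt_pow 2 t).smul_const p
    convert! (h1.const_add x).add h2 using 1
    simp
  have hγ0 : γ 0 = x := by simp [hγ]
  have hcont : Tendsto γ (𝓝 0) (𝓝 x) := by
    have := (hγ' 0).continuousAt.tendsto
    rwa [hγ0] at this
  have key := HasSecondOrderExpansion.of_hasDerivAt (g := fun t => f (γ t))
    (g' := fun t => fderiv ℝ f (γ t) (v + (2 * t) • p))
    (c := hess f x v v + 2 * fderiv ℝ f x p) (by
      filter_upwards [hcont.eventually hf.eventually_differentiableAt_two] with t ht
      exact ht.hasFDerivAt.comp_hasDerivAt t (hγ' t)) (by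
      have h1 : HasDerivAt (fun t => fderiv ℝ f (γ t)) (hess f x v) 0 := by
        have hx : HasFDerivAt (fderiv ℝ f) (hess f x) (γ 0) := by
          rw [hγ0]; exact hf.hasFDerivAt_fderiv
        have h := hx.comp_hasDerivAt 0 (hγ' 0)
        rw [mul_zero, zero_smul, add_zero] at h
        exact h
      have h2 : HasDerivAt (fun t : ℝ => v + (2 * t) • p) ((2 : ℝ) • p) 0 := by
        have := (((hasDerivAt_id (0 : ℝ)).const_mul 2).smul_const p).const_add v
        simpa using this
      have := h1.clm_apply h2
      simpa [hγ0] using this)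
  simpa [hγ0] using key

/-- Second-order Taylor expansion of `f` along the line `t ↦ x + t v`. -/
lemma ContDiffAt.hasSecondOrderExpansion_line (hf : ContDiffAt ℝ 2 f x) (v : E) :
    HasSecondOrderExpansion (fun t => f (x + t • v)) (f x) (fderiv ℝ f x v) (hess f x v v) := by
  simpa using hf.hasSecondOrderExpansion v 0

end

/-! ### Separation of two functionals -/

section

variable {E : Type*} [NormedAddCommGroup E] [InnerProductSpace ℝ E]

/-- Gordan's alternative for two vectors: if no direction makes a negative inner product with both
`a` and `b`, then `0` lies on the segment between them. -/
lemma exists_convex_comb_eq_zero {a b : E}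
    (h : ∀ w : E, inner ℝ a w < 0 → ¬ inner ℝ b w < 0) :
    ∃ l : ℝ, 0 ≤ l ∧ l ≤ 1 ∧ l • a + (1 - l) • b = 0 := by
  by_cases ha : a = 0
  · exact ⟨1, by simp [ha]⟩
  by_cases hb : b = 0
  · exact ⟨0, by simp [hb]⟩
  have ha' : 0 < ‖a‖ := norm_pos_iff.2 ha
  have hb' : 0 < ‖b‖ := norm_pos_iff.2 hb
  have haa := real_inner_self_eq_norm_sq a
  have hbb := real_inner_self_eq_norm_sq b
  have hab := real_inner_comm a b
  set w := ‖b‖ • a + ‖a‖ • b with hw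
  have hcs : -(‖a‖ * ‖b‖) ≤ inner ℝ a b := (abs_le.1 (abs_real_inner_le_norm a b)).1
  have h1 : inner ℝ a w = ‖a‖ * (‖a‖ * ‖b‖ + inner ℝ a b) := by
    rw [hw, inner_add_right, inner_smul_right, inner_smul_right, haa]; ring
  have h2 : inner ℝ b w = ‖b‖ * (‖a‖ * ‖b‖ + inner ℝ a b) := by
    rw [hw, inner_add_right, inner_smul_right, inner_smul_right, hbb, hab]; ring
  rcases hcs.lt_or_eq with hlt | heq
  · exfalso
    have hpos : 0 < ‖a‖ * ‖b‖ + inner ℝ a b := by linarith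
    refine h (-w) ?_ ?_
    · rw [inner_neg_right, h1]; have := mul_pos ha' hpos; linarith
    · rw [inner_neg_right, h2]; have := mul_pos hb' hpos; linarith
  · have hw0 : w = 0 := by
      rw [← inner_self_eq_zero (𝕜 := ℝ)]
      have : inner ℝ w w = ‖b‖ * inner ℝ a w + ‖a‖ * inner ℝ b w := by
        nth_rewrite 1 [hw]
        rw [inner_add_left, inner_smul_left, inner_smul_left]
        simp
      rw [this, h1, h2, ← heq]; ring
    refine ⟨‖b‖ / (‖a‖ + ‖b‖), by positivity, ?_, ?_⟩
    · rw [div_le_one (by positivity)]; linarith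
    · have : 1 - ‖b‖ / (‖a‖ + ‖b‖) = ‖a‖ / (‖a‖ + ‖b‖) := by field_simp; ring
      rw [this, div_eq_inv_mul, div_eq_inv_mul, mul_smul, mul_smul, ← smul_add, ← hw, hw0,
        smul_zero]

end

/-! ### Two-point minima -/

lemma tendsto_parabola {E : Type*} [NormedAddCommGroup E] [NormedSpace ℝ E] (a v p : E) :
    Tendsto (fun t : ℝ => a + t • v + t ^ 2 • p) (𝓝 0) (𝓝 a) := by
  have : Continuous fun t : ℝ => a + t • v + t ^ 2 • p := by fun_prop
  simpa using this.tendsto 0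

section

variable {E : Type*} [NormedAddCommGroup E] [InnerProductSpace ℝ E] [CompleteSpace E]
  {u f T : E → ℝ} {x y : E}

/-- Expansion of `f((a + b) / 2) - T (a - b)` along a pair of parabolas. -/
lemma hasSecondOrderExpansion_twoPoint (hf : ContDiffAt ℝ 2 f ((1 / 2 : ℝ) • (x + y)))
    (hT : ContDiffAt ℝ 2 T (x - y)) {g₁ g₂ : E}
    (hg₁ : g₁ = (1 / 2 : ℝ) • gradient f ((1 / 2 : ℝ) • (x + y)) - gradient T (x - y))
    (hg₂ : g₂ = (1 / 2 : ℝ) • gradient f ((1 / 2 : ℝ) • (x + y)) + gradient T (x - y))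
    (v w p q : E) :
    HasSecondOrderExpansion
      (fun t => f ((1 / 2 : ℝ) • ((x + t • v + t ^ 2 • p) + (y + t • w + t ^ 2 • q)))
        - T ((x + t • v + t ^ 2 • p) - (y + t • w + t ^ 2 • q)))
      (f ((1 / 2 : ℝ) • (x + y)) - T (x - y))
      (inner ℝ g₁ v + inner ℝ g₂ w)
      (hess f ((1 / 2 : ℝ) • (x + y)) ((1 / 2 : ℝ) • (v + w)) ((1 / 2 : ℝ) • (v + w))
        - hess T (x - y) (v - w) (v - w) + 2 * (inner ℝ g₁ p + inner ℝ g₂ q)) := by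
  have h := (hf.hasSecondOrderExpansion ((1 / 2 : ℝ) • (v + w)) ((1 / 2 : ℝ) • (p + q))).sub
    (hT.hasSecondOrderExpansion (v - w) (p - q))
  convert h using 1
  · funext t
    congr 2
    · module
    · module
  · subst hg₁ hg₂
    simp only [inner_sub_left, inner_add_left, inner_smul_left, inner_gradient_left, map_smul,
      map_add, map_sub, smul_eq_mul, RCLike.conj_to_real]
    ring
  · subst hg₁ hg₂
    simp only [inner_sub_left, inner_add_left, inner_smul_left, inner_gradient_left, map_smul,
      map_add, map_sub, smul_eq_mul, RCLike.conj_to_real]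
    ring

/-- First and second order necessary conditions at a local minimum `(x, y)` of
`f ((a + b) / 2) - T (a - b) - min (u a) (u b)` at which both arguments of the `min` are equal.
The multiplier `l` distributes the constraint between the two points; the second-order condition
holds for all variations `(v, w)` that change `u` at the same rate at both points. -/
lemma twoPoint_min_conditions (hux : ContDiffAt ℝ 2 u x) (huy : ContDiffAt ℝ 2 u y)
    (hf : ContDiffAt ℝ 2 f ((1 / 2 : ℝ) • (x + y))) (hT : ContDiffAt ℝ 2 T (x - y))
    (hxy : u x = u y) (hgx : gradient u x ≠ 0) (hgy : gradient u y ≠ 0)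
    (hmin : ∀ᶠ q : E × E in 𝓝 (x, y),
      f ((1 / 2 : ℝ) • (x + y)) - T (x - y) - u x ≤
        f ((1 / 2 : ℝ) • (q.1 + q.2)) - T (q.1 - q.2) - min (u q.1) (u q.2)) :
    ∃ l : ℝ, 0 ≤ l ∧ l ≤ 1 ∧
      (1 / 2 : ℝ) • gradient f ((1 / 2 : ℝ) • (x + y)) - gradient T (x - y) = l • gradient u x ∧
      (1 / 2 : ℝ) • gradient f ((1 / 2 : ℝ) • (x + y)) + gradient T (x - y)
        = (1 - l) • gradient u y ∧
      ∀ v w : E, inner ℝ (gradient u x) v = inner ℝ (gradient u y) w →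
        0 ≤ hess f ((1 / 2 : ℝ) • (x + y)) ((1 / 2 : ℝ) • (v + w)) ((1 / 2 : ℝ) • (v + w))
          - hess T (x - y) (v - w) (v - w) - l * hess u x v v - (1 - l) * hess u y w w := by
  set P := gradient u x with hP
  set R := gradient u y with hR
  set g₁ := (1 / 2 : ℝ) • gradient f ((1 / 2 : ℝ) • (x + y)) - gradient T (x - y) with hg₁
  set g₂ := (1 / 2 : ℝ) • gradient f ((1 / 2 : ℝ) • (x + y)) + gradient T (x - y) with hg₂
  have hK := hasSecondOrderExpansion_twoPoint hf hT hg₁ hg₂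
  have hX : ∀ v p : E, HasSecondOrderExpansion (fun t => u (x + t • v + t ^ 2 • p)) (u x)
      (inner ℝ P v) (hess u x v v + 2 * inner ℝ P p) := fun v p => by
    simpa [hP] using hux.hasSecondOrderExpansion v p
  have hY : ∀ v p : E, HasSecondOrderExpansion (fun t => u (y + t • v + t ^ 2 • p)) (u y)
      (inner ℝ R v) (hess u y v v + 2 * inner ℝ R p) := fun v p => by
    simpa [hR] using huy.hasSecondOrderExpansion v p
  have hcurve : ∀ v w p q : E, ∀ᶠ t : ℝ in 𝓝 0,
      ¬ (f ((1 / 2 : ℝ) • ((x + t • v + t ^ 2 • p) + (y + t • w + t ^ 2 • q)))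
          - T ((x + t • v + t ^ 2 • p) - (y + t • w + t ^ 2 • q))
          - u (x + t • v + t ^ 2 • p) < f ((1 / 2 : ℝ) • (x + y)) - T (x - y) - u x ∧
        f ((1 / 2 : ℝ) • ((x + t • v + t ^ 2 • p) + (y + t • w + t ^ 2 • q)))
          - T ((x + t • v + t ^ 2 • p) - (y + t • w + t ^ 2 • q))
          - u (y + t • w + t ^ 2 • q) < f ((1 / 2 : ℝ) • (x + y)) - T (x - y) - u y) := by
    intro v w p q
    have ht := ((tendsto_parabola x v p).prodMk_nhds (tendsto_parabola y w q)).eventually hmin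
    filter_upwards [ht] with t ht
    rintro ⟨h1, h2⟩
    rcases min_choice (u (x + t • v + t ^ 2 • p)) (u (y + t • w + t ^ 2 • q)) with h | h <;>
      rw [h] at ht <;> linarith
  -- first order: no variation lowers both branches of the minimum
  have first : ∀ v w : E, inner ℝ g₁ v + inner ℝ g₂ w < inner ℝ P v →
      ¬ inner ℝ g₁ v + inner ℝ g₂ w < inner ℝ R w := by
    intro v w h1 h2
    have e1 := ((hK v w 0 0).sub (hX v 0)).eventually_lt_of_neg (by linarith)
    have e2 := ((hK v w 0 0).sub (hY w 0)).eventually_lt_of_neg (by linarith)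
    obtain ⟨t, ht, ht1, ht2⟩ := (((hcurve v w 0 0).filter_mono nhdsWithin_le_nhds).and (e1.and e2)).exists
    exact ht ⟨ht1, ht2⟩
  obtain ⟨l, hl0, hl1, hl⟩ := exists_convex_comb_eq_zero (a := g₁ - P) (b := g₁) (fun v h1 h2 => by
    rw [inner_sub_left] at h1
    exact first v 0 (by simp only [inner_zero_right]; linarith) (by simpa using h2))
  obtain ⟨m, hm0, hm1, hm⟩ := exists_convex_comb_eq_zero (a := g₂ - R) (b := g₂) (fun v h1 h2 => by
    rw [inner_sub_left] at h1
    exact first 0 v (by simpa using h2) (by simp only [inner_zero_right]; linarith))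
  have hl' : g₁ = l • P := by
    rw [← sub_eq_zero, ← hl]; module
  have hm' : g₂ = m • R := by
    rw [← sub_eq_zero, ← hm]; module
  have hPP : 0 < ‖P‖ ^ 2 := by have := norm_pos_iff.2 hgx; positivity
  have hRR : 0 < ‖R‖ ^ 2 := by have := norm_pos_iff.2 hgy; positivity
  have hlm : m = 1 - l := by
    have key : ∀ s : ℝ, ¬ (l + m) * s < s := by
      intro s hs
      have e1 : inner ℝ P ((s / ‖P‖ ^ 2) • P) = s := by
        rw [inner_smul_right, real_inner_self_eq_norm_sq]; field_simp
      have e2 : inner ℝ R ((s / ‖R‖ ^ 2) • R) = s := by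
        rw [inner_smul_right, real_inner_self_eq_norm_sq]; field_simp
      have e3 : inner ℝ g₁ ((s / ‖P‖ ^ 2) • P) + inner ℝ g₂ ((s / ‖R‖ ^ 2) • R) = (l + m) * s := by
        rw [hl', hm', inner_smul_left, inner_smul_left, e1, e2]
        simp; ring
      exact first ((s / ‖P‖ ^ 2) • P) ((s / ‖R‖ ^ 2) • R) (by rw [e1, e3]; exact hs)
        (by rw [e2, e3]; exact hs)
    have k1 := key 1
    have k2 := key (-1)
    linarith
  subst hlm
  refine ⟨l, hl0, hl1, hl', hm', fun v w hvw => ?_⟩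
  by_contra hneg
  push Not at hneg
  -- corrections that make `u` stationary to second order along both curves
  set p := (-(hess u x v v) / (2 * ‖P‖ ^ 2)) • P with hp
  set q := (-(hess u y w w) / (2 * ‖R‖ ^ 2)) • R with hq
  have hPp : inner ℝ P p = -(hess u x v v) / 2 := by
    rw [hp, inner_smul_right, real_inner_self_eq_norm_sq]; field_simp
  have hRq : inner ℝ R q = -(hess u y w w) / 2 := by
    rw [hq, inner_smul_right, real_inner_self_eq_norm_sq]; field_simp
  have hk1 : inner ℝ g₁ v + inner ℝ g₂ w = inner ℝ P v := by
    rw [hl', hm', inner_smul_left, inner_smul_left, ← hvw]; simp; ring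
  have hk2 : inner ℝ g₁ p + inner ℝ g₂ q
      = l * (-(hess u x v v) / 2) + (1 - l) * (-(hess u y w w) / 2) := by
    rw [hl', hm', inner_smul_left, inner_smul_left, hPp, hRq]; simp
  have hKX := (hK v w p q).sub (hX v p)
  have hKY := (hK v w p q).sub (hY w q)
  rw [hk1, sub_self] at hKX
  rw [hk1, hvw, sub_self] at hKY
  have e1 := hKX.eventually_lt (by rw [hk2, hPp]; linarith)
  have e2 := hKY.eventually_lt (by rw [hk2, hRq]; linarith)
  obtain ⟨t, ht, ht1, ht2⟩ := (((hcurve v w p q).filter_mono nhdsWithin_le_nhds).and (e1.and e2)).exists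
  exact ht ⟨ht1, ht2⟩

end

/-! ### Linear algebra of the second-order condition -/

section

variable {E : Type*} [NormedAddCommGroup E] [InnerProductSpace ℝ E]

/-- The Hessian of a harmonic function is trace-free. -/
lemma InnerProductSpace.HarmonicAt.sum_hess_eq_zero [FiniteDimensional ℝ E] {u : E → ℝ} {x : E}
    (h : InnerProductSpace.HarmonicAt u x) {ι : Type*} [Fintype ι] (b : OrthonormalBasis ι ℝ E) :
    ∑ i, hess u x (b i) (b i) = 0 := by
  have h1 := h.2.self_of_nhds
  rw [InnerProductSpace.laplacian_eq_iteratedFDeriv_orthonormalBasis u b] at h1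
  simpa [iteratedFDeriv_two_apply] using h1

/-- For `l P = (1 - l) R`, the variations `(l e, (1 - l) e)` are admissible for every `e`. Summed
over an orthonormal basis they contradict a midpoint function of negative Laplacian. -/
lemma false_of_parallel_second_order [FiniteDimensional ℝ E] {Hx Hy Hz : E →L[ℝ] E →L[ℝ] ℝ}
    {P R : E} {l : ℝ} (hPR : l • P = (1 - l) • R) {ι : Type*} [Fintype ι]
    (b : OrthonormalBasis ι ℝ E)
    (hx : ∑ i, Hx (b i) (b i) = 0) (hy : ∑ i, Hy (b i) (b i) = 0) (hz : ∑ i, Hz (b i) (b i) < 0)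
    (h : ∀ v w : E, inner ℝ P v = inner ℝ R w →
      0 ≤ Hz ((1 / 2 : ℝ) • (v + w)) ((1 / 2 : ℝ) • (v + w)) - l * Hx v v - (1 - l) * Hy w w) :
    False := by
  have key : ∀ i, 0 ≤ 1 / 4 * Hz (b i) (b i) - l ^ 3 * Hx (b i) (b i)
      - (1 - l) ^ 3 * Hy (b i) (b i) := by
    intro i
    have h1 := h (l • b i) ((1 - l) • b i) (by
      have := congrArg (fun a => inner ℝ a (b i)) hPR
      simpa [inner_smul_left, inner_smul_right] using this)
    have h2 : (1 / 2 : ℝ) • (l • b i + (1 - l) • b i) = (1 / 2 : ℝ) • b i := by module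
    rw [h2] at h1
    simp only [map_smul, smul_apply, smul_eq_mul] at h1
    linarith
  have hsum := Finset.sum_nonneg fun i (_ : i ∈ Finset.univ) => key i
  rw [Finset.sum_sub_distrib, Finset.sum_sub_distrib, ← Finset.mul_sum, ← Finset.mul_sum,
    ← Finset.mul_sum, hx, hy] at hsum
  linarith

/-- Any two vectors lie in the span of the first two vectors of an orthonormal basis, the first of
them in the span of the first basis vector. -/
lemma exists_orthonormalBasis_adapted [FiniteDimensional ℝ E] {m : ℕ}
    (hm : Module.finrank ℝ E = m + 2) (P R : E) :
    ∃ b : OrthonormalBasis (Fin (m + 2)) ℝ E, P = inner ℝ (b 0) P • b 0 ∧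
      R = inner ℝ (b 0) R • b 0 + inner ℝ (b 1) R • b 1 := by
  set f : Fin (m + 2) → E := fun i => if i = 0 then P else if i = 1 then R else 0 with hf
  have hcard : Module.finrank ℝ E = Fintype.card (Fin (m + 2)) := by simpa using hm
  set b := InnerProductSpace.gramSchmidtOrthonormalBasis hcard f with hb
  have hP : ∀ j : Fin (m + 2), 0 < j → inner ℝ (b j) P = 0 := fun j hj => by
    simpa [hf] using InnerProductSpace.gramSchmidtOrthonormalBasis_inv_triangular hcard f hj
  have hR : ∀ j : Fin (m + 2), 1 < j → inner ℝ (b j) R = 0 := fun j hj => by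
    simpa [hf] using InnerProductSpace.gramSchmidtOrthonormalBasis_inv_triangular hcard f hj
  refine ⟨b, ?_, ?_⟩
  · conv_lhs => rw [← b.sum_repr' P]
    rw [Fin.sum_univ_succ]
    rw [Finset.sum_eq_zero fun i _ => by rw [hP _ (Fin.succ_pos i), zero_smul], add_zero]
  · conv_lhs => rw [← b.sum_repr' R]
    rw [Fin.sum_univ_succ, Fin.sum_univ_succ]
    rw [Finset.sum_eq_zero fun i _ => by
      rw [hR _ (by rw [Fin.lt_def]; simp), zero_smul], add_zero]
    rfl

set_option maxHeartbeats 1000000 in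
/-- The second-order condition fails when `P` and `R` are independent, the three Hessians are
trace-free, the middle one is nonpositive orthogonally to `P` and `R`, and `HT` is positive.
In the plane of `P` and `R` the variations are the complex multiples by the inversions of `P` and
`R`, and on its orthogonal complement the dilations by `1 / |P|` and `1 / |R|`; on each of the two
pieces the restriction of `Hx` and of `Hy` enters through its trace only. -/
lemma false_of_independent_second_order [FiniteDimensional ℝ E]
    {Hx Hy Hz HT : E →L[ℝ] E →L[ℝ] ℝ} {P R : E} {l : ℝ}
    (hdim : 2 ≤ Module.finrank ℝ E) (hP : P ≠ 0) (hPR : ∀ s : ℝ, R ≠ s • P)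
    (hx : ∀ b : OrthonormalBasis (Fin (Module.finrank ℝ E)) ℝ E, ∑ i, Hx (b i) (b i) = 0)
    (hy : ∀ b : OrthonormalBasis (Fin (Module.finrank ℝ E)) ℝ E, ∑ i, Hy (b i) (b i) = 0)
    (hz : ∀ b : OrthonormalBasis (Fin (Module.finrank ℝ E)) ℝ E, ∑ i, Hz (b i) (b i) = 0)
    (hz' : ∀ v, inner ℝ P v = 0 → inner ℝ R v = 0 → Hz v v ≤ 0)
    (hT : ∀ v, v ≠ 0 → 0 < HT v v)
    (h : ∀ v w : E, inner ℝ P v = inner ℝ R w →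
      0 ≤ Hz ((1 / 2 : ℝ) • (v + w)) ((1 / 2 : ℝ) • (v + w)) - HT (v - w) (v - w)
        - l * Hx v v - (1 - l) * Hy w w) :
    False := by
  obtain ⟨m, hm⟩ := Nat.exists_eq_add_of_le' hdim
  rw [hm] at hx hy hz
  obtain ⟨b, hPb, hRb⟩ := exists_orthonormalBasis_adapted hm P R
  set p := inner ℝ (b 0) P with hp
  set r := inner ℝ (b 0) R with hr
  set s := inner ℝ (b 1) R with hs
  have hp0 : p ≠ 0 := by
    intro h0; rw [h0, zero_smul] at hPb; exact hP hPb
  have hs0 : s ≠ 0 := by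
    intro h0
    refine hPR (r / p) ?_
    rw [hPb, hRb, h0, smul_smul, div_mul_cancel₀ _ hp0]; simp
  have hb : ∀ i j, inner ℝ (b i) (b j) = if i = j then (1 : ℝ) else 0 :=
    orthonormal_iff_ite.1 b.orthonormal
  have hb01 : inner ℝ (b 0) (b 1) = (0 : ℝ) := by rw [hb]; simp
  have hb10 : inner ℝ (b 1) (b 0) = (0 : ℝ) := by rw [hb]; simp
  have hb00 : inner ℝ (b 0) (b 0) = (1 : ℝ) := by rw [hb]; simp
  have hb11 : inner ℝ (b 1) (b 1) = (1 : ℝ) := by rw [hb]; simp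
  have hb0i : ∀ i : Fin m, inner ℝ (b 0) (b i.succ.succ) = (0 : ℝ) := fun i => by
    rw [hb, if_neg (Fin.succ_ne_zero _).symm]
  have hb1i : ∀ i : Fin m, inner ℝ (b 1) (b i.succ.succ) = (0 : ℝ) := fun i => by
    rw [hb, if_neg]
    rw [← Fin.succ_zero_eq_one, Fin.succ_inj]
    exact (Fin.succ_ne_zero _).symm
  have hN : 0 < r ^ 2 + s ^ 2 := by positivity
  set a := 1 / p with ha
  set c := r / (r ^ 2 + s ^ 2) with hc
  set d := s / (r ^ 2 + s ^ 2) with hd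
  set q := Real.sqrt (c ^ 2 + d ^ 2) with hq
  have hd0 : d ≠ 0 := div_ne_zero hs0 hN.ne'
  have hq2 : q ^ 2 = c ^ 2 + d ^ 2 := Real.sq_sqrt (by positivity)
  have hq0 : 0 ≤ q := Real.sqrt_nonneg _
  have hrs : r * c + s * d = 1 := by rw [hc, hd]; field_simp
  have hrs' : r * (-d) + s * c = 0 := by rw [hc, hd]; field_simp; ring
  have hpa : p * a = 1 := by rw [ha]; field_simp
  have I0 := h (a • b 0) (c • b 0 + d • b 1) (by
    rw [hPb, hRb]
    simp only [inner_add_left, inner_add_right, inner_smul_left, inner_smul_right, hb00, hb11,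
      hb01, hb10, RCLike.conj_to_real]
    linarith)
  have I1 := h (a • b 1) ((-d) • b 0 + c • b 1) (by
    rw [hPb, hRb]
    simp only [inner_add_left, inner_add_right, inner_smul_left, inner_smul_right, hb00, hb11,
      hb01, hb10, RCLike.conj_to_real]
    linarith)
  have hPi : ∀ i : Fin m, inner ℝ P (b i.succ.succ) = 0 := fun i => by
    rw [hPb]; simp only [inner_smul_left, hb0i, mul_zero]
  have hRi : ∀ i : Fin m, inner ℝ R (b i.succ.succ) = 0 := fun i => by
    rw [hRb]; simp only [inner_add_left, inner_smul_left, hb0i, hb1i, mul_zero, add_zero]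
  have Ii : ∀ i : Fin m, 0 ≤ 1 / 4 * (|a| + q) ^ 2 * Hz (b i.succ.succ) (b i.succ.succ)
      - l * a ^ 2 * Hx (b i.succ.succ) (b i.succ.succ)
      - (1 - l) * q ^ 2 * Hy (b i.succ.succ) (b i.succ.succ) := fun i => by
    have h1 := h (|a| • b i.succ.succ) (q • b i.succ.succ) (by
      rw [inner_smul_right, inner_smul_right, hPi, hRi, mul_zero, mul_zero])
    rw [← add_smul, ← sub_smul] at h1
    have h2 : 0 ≤ HT (b i.succ.succ) (b i.succ.succ) := (hT _ (b.orthonormal.ne_zero _)).le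
    simp only [map_smul, smul_apply, smul_eq_mul] at h1
    have h3 : 0 ≤ (|a| - q) * ((|a| - q) * HT (b i.succ.succ) (b i.succ.succ)) := by
      rw [← mul_assoc]; exact mul_nonneg (mul_self_nonneg _) h2
    have h4 : |a| * |a| = a ^ 2 := by rw [← sq, sq_abs]
    have h5 : |a| * (|a| * Hx (b i.succ.succ) (b i.succ.succ))
        = a ^ 2 * Hx (b i.succ.succ) (b i.succ.succ) := by rw [← mul_assoc, h4]
    rw [h5] at h1
    linarith
  have hsum := Finset.sum_nonneg fun i (_ : i ∈ Finset.univ) => Ii i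
  rw [Finset.sum_sub_distrib, Finset.sum_sub_distrib, ← Finset.mul_sum, ← Finset.mul_sum,
    ← Finset.mul_sum] at hsum
  have tx := hx b
  have ty := hy b
  have tz := hz b
  rw [Fin.sum_univ_succ, Fin.sum_univ_succ] at tx ty tz
  simp only [Fin.succ_zero_eq_one] at tx ty tz
  set Sx := ∑ i : Fin m, Hx (b i.succ.succ) (b i.succ.succ)
  set Sy := ∑ i : Fin m, Hy (b i.succ.succ) (b i.succ.succ)
  set Sz := ∑ i : Fin m, Hz (b i.succ.succ) (b i.succ.succ) with hSz
  have hSz0 : Sz ≤ 0 := Finset.sum_nonpos fun i _ => hz' _ (hPi i) (hRi i)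
  have T0 : 0 < HT (a • b 0 - (c • b 0 + d • b 1)) (a • b 0 - (c • b 0 + d • b 1)) := by
    refine hT _ fun h0 => hd0 ?_
    have := congrArg (fun v => inner ℝ (b 1) v) h0
    simpa [inner_sub_right, inner_add_right, inner_smul_right, hb11, hb10] using this
  have T1 : 0 ≤ HT (a • b 1 - ((-d) • b 0 + c • b 1)) (a • b 1 - ((-d) • b 0 + c • b 1)) := by
    refine (hT _ fun h0 => hd0 ?_).le
    have := congrArg (fun v => inner ℝ (b 0) v) h0
    simpa [inner_sub_right, inner_add_right, inner_smul_right, hb00, hb01] using this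
  have I01 : 0 < 1 / 4 * ((a + c) ^ 2 + d ^ 2) * (Hz (b 0) (b 0) + Hz (b 1) (b 1))
      - l * a ^ 2 * (Hx (b 0) (b 0) + Hx (b 1) (b 1))
      - (1 - l) * q ^ 2 * (Hy (b 0) (b 0) + Hy (b 1) (b 1)) := by
    rw [hq2]
    have I0' := add_lt_add_of_le_of_lt I0 T0
    have I1' := add_le_add I1 T1
    simp only [map_smul, map_add, smul_apply, add_apply,
      smul_eq_mul] at I0' I1'
    ring_nf at I0' I1' ⊢
    linarith
  have e1 : Hz (b 0) (b 0) + Hz (b 1) (b 1) = -Sz := by linarith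
  have e2 : Hx (b 0) (b 0) + Hx (b 1) (b 1) = -Sx := by linarith
  have e3 : Hy (b 0) (b 0) + Hy (b 1) (b 1) = -Sy := by linarith
  rw [e1, e2, e3] at I01
  have hac : a * c ≤ |a| * q := by
    calc a * c ≤ |a * c| := le_abs_self _
      _ = |a| * |c| := abs_mul _ _
      _ ≤ |a| * q := by
        refine mul_le_mul_of_nonneg_left (Real.abs_le_sqrt ?_) (abs_nonneg _)
        have := sq_nonneg d
        linarith
  have hfin : 0 < 1 / 4 * ((|a| + q) ^ 2 - ((a + c) ^ 2 + d ^ 2)) * Sz := by linarith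
  have hcoef : 0 ≤ (|a| + q) ^ 2 - ((a + c) ^ 2 + d ^ 2) := by
    have : (|a| + q) ^ 2 = a ^ 2 + 2 * (|a| * q) + (c ^ 2 + d ^ 2) := by
      rw [add_sq, sq_abs, hq2]; ring
    rw [this]; linarith
  have := mul_nonpos_of_nonneg_of_nonpos hcoef hSz0
  linarith

end

/-! ### The convex penalty and the quadratic perturbation -/

section

variable {E : Type*} [NormedAddCommGroup E]

/-- The convex function `k (r √(|w|² + r²) - r²)`. At the origin it has Hessian `k`, while its
gradient is bounded by `k r`; so as `r → 0` it tends to zero uniformly on bounded sets without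
losing its curvature at the origin. -/
noncomputable def penalty (k r : ℝ) (w : E) : ℝ :=
  k * (r * Real.sqrt (‖w‖ ^ 2 + r ^ 2) - r ^ 2)

variable {k r : ℝ}

lemma penalty_zero (hr : 0 < r) : penalty k r (0 : E) = 0 := by
  simp [penalty, Real.sqrt_sq hr.le]
  right; ring

lemma penalty_neg (w : E) : penalty k r (-w) = penalty k r w := by simp [penalty]

lemma penalty_le_sq (hk : 0 ≤ k) (hr : 0 < r) (w : E) : penalty k r w ≤ k / 2 * ‖w‖ ^ 2 := by
  have h0 := Real.sq_sqrt (show 0 ≤ ‖w‖ ^ 2 + r ^ 2 by positivity)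
  have : r * Real.sqrt (‖w‖ ^ 2 + r ^ 2) - r ^ 2 ≤ ‖w‖ ^ 2 / 2 := by
    nlinarith [sq_nonneg (Real.sqrt (‖w‖ ^ 2 + r ^ 2) - r)]
  have := mul_le_mul_of_nonneg_left this hk
  unfold penalty; linarith

lemma penalty_le_norm (hk : 0 ≤ k) (hr : 0 < r) (w : E) : penalty k r w ≤ k * r * ‖w‖ := by
  have h : Real.sqrt (‖w‖ ^ 2 + r ^ 2) ≤ ‖w‖ + r :=
    Real.sqrt_le_iff.2 ⟨by positivity, by nlinarith [mul_nonneg (norm_nonneg w) hr.le]⟩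
  have : r * Real.sqrt (‖w‖ ^ 2 + r ^ 2) - r ^ 2 ≤ r * ‖w‖ := by nlinarith
  have := mul_le_mul_of_nonneg_left this hk
  unfold penalty; linarith

variable [InnerProductSpace ℝ E]

lemma contDiff_penalty (hr : 0 < r) : ContDiff ℝ 2 (penalty k r : E → ℝ) := by
  have h : ContDiff ℝ 2 fun w : E => Real.sqrt (‖w‖ ^ 2 + r ^ 2) :=
    ((contDiff_norm_sq ℝ).add contDiff_const).sqrt fun w => by positivity
  exact contDiff_const.mul ((contDiff_const.mul h).sub contDiff_const)

lemma hasFDerivAt_softNorm (hr : 0 < r) (w : E) :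
    HasFDerivAt (fun w : E => Real.sqrt (‖w‖ ^ 2 + r ^ 2))
      ((Real.sqrt (‖w‖ ^ 2 + r ^ 2))⁻¹ • innerSL ℝ w) w := by
  have h := ((hasStrictFDerivAt_norm_sq w).hasFDerivAt.add_const (r ^ 2)).sqrt
    (by positivity : ‖w‖ ^ 2 + r ^ 2 ≠ 0)
  convert h using 1
  ext v
  simp
  field_simp

lemma fderiv_penalty (hr : 0 < r) :
    fderiv ℝ (penalty k r : E → ℝ)
      = fun w => (k * r * (Real.sqrt (‖w‖ ^ 2 + r ^ 2))⁻¹) • innerSL ℝ w := by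
  funext w
  have h := (((hasFDerivAt_softNorm hr w).const_mul r).sub_const (r ^ 2)).const_mul k
  rw [show fderiv ℝ (penalty k r : E → ℝ) w = _ from h.fderiv]
  ext v
  simp
  ring

lemma gradient_penalty [CompleteSpace E] (hr : 0 < r) (w : E) :
    gradient (penalty k r : E → ℝ) w = (k * r * (Real.sqrt (‖w‖ ^ 2 + r ^ 2))⁻¹) • w := by
  refine ext_inner_right ℝ fun v => ?_
  rw [inner_gradient_left, fderiv_penalty hr]
  simp [inner_smul_left]

lemma norm_gradient_penalty_le [CompleteSpace E] (hk : 0 ≤ k) (hr : 0 < r) (w : E) :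
    ‖gradient (penalty k r : E → ℝ) w‖ ≤ k * r := by
  have hS : 0 < Real.sqrt (‖w‖ ^ 2 + r ^ 2) := by positivity
  rw [gradient_penalty hr, norm_smul, Real.norm_of_nonneg (by positivity), mul_assoc]
  refine mul_le_of_le_one_right (by positivity) ?_
  rw [inv_mul_le_one₀ hS]
  exact Real.le_sqrt_of_sq_le (by nlinarith [sq_nonneg r])

lemma hess_penalty (hr : 0 < r) (w v : E) :
    hess (penalty k r : E → ℝ) w v v = k * r * (Real.sqrt (‖w‖ ^ 2 + r ^ 2))⁻¹ ^ 3
      * (r ^ 2 * ‖v‖ ^ 2 + (‖w‖ ^ 2 * ‖v‖ ^ 2 - inner ℝ w v ^ 2)) := by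
  have hS : 0 < Real.sqrt (‖w‖ ^ 2 + r ^ 2) := by positivity
  have hS2 := Real.sq_sqrt (show 0 ≤ ‖w‖ ^ 2 + r ^ 2 by positivity)
  have h1 := ((hasDerivAt_inv hS.ne').comp_hasFDerivAt w
    (hasFDerivAt_softNorm hr w)).const_mul (k * r)
  have h2 : HasFDerivAt (fun w : E => innerSL ℝ w) (innerSL ℝ : E →L[ℝ] E →L[ℝ] ℝ) w :=
    (innerSL ℝ : E →L[ℝ] E →L[ℝ] ℝ).hasFDerivAt
  have h3 : HasFDerivAt
      (fun w : E => (k * r * (Real.sqrt (‖w‖ ^ 2 + r ^ 2))⁻¹) • innerSL ℝ w) _ w := h1.smul h2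
  rw [← fderiv_penalty hr] at h3
  rw [hess, h3.fderiv]
  set S := Real.sqrt (‖w‖ ^ 2 + r ^ 2)
  simp
  rw [show r ^ 2 * ‖v‖ ^ 2 + (‖w‖ ^ 2 * ‖v‖ ^ 2 - inner ℝ w v ^ 2)
    = S ^ 2 * ‖v‖ ^ 2 - inner ℝ w v ^ 2 by rw [hS2]; ring]
  field_simp
  rw [innerSL_apply_apply, real_inner_self_eq_norm_sq,
    show Real.sqrt (‖w‖ ^ 2 + r ^ 2) = S from rfl]
  ring

lemma hess_penalty_pos (hk : 0 < k) (hr : 0 < r) (w : E) {v : E} (hv : v ≠ 0) :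
    0 < hess (penalty k r : E → ℝ) w v v := by
  have hS : 0 < Real.sqrt (‖w‖ ^ 2 + r ^ 2) := by positivity
  have hv' : 0 < ‖v‖ := norm_pos_iff.2 hv
  have hcs : inner ℝ w v ^ 2 ≤ ‖w‖ ^ 2 * ‖v‖ ^ 2 := by
    rw [← mul_pow, ← sq_abs]
    exact pow_le_pow_left₀ (abs_nonneg _) (abs_real_inner_le_norm w v) 2
  rw [hess_penalty hr]
  have : 0 < r ^ 2 * ‖v‖ ^ 2 := by positivity
  have : 0 < r ^ 2 * ‖v‖ ^ 2 + (‖w‖ ^ 2 * ‖v‖ ^ 2 - inner ℝ w v ^ 2) := by linarith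
  positivity

lemma hess_penalty_zero (hr : 0 < r) (v : E) :
    hess (penalty k r : E → ℝ) 0 v v = k * ‖v‖ ^ 2 := by
  rw [hess_penalty hr]
  simp [Real.sqrt_sq hr.le]
  field_simp

/-- Subtracting `ε |x|²` lowers the Hessian by `2 ε` times the inner product. -/
lemma hess_sub_norm_sq {u : E → ℝ} {x : E} (hu : ContDiffAt ℝ 2 u x) (ε : ℝ) (v : E) :
    hess (fun y => u y - ε * ‖y‖ ^ 2) x v v = hess u x v v - 2 * ε * ‖v‖ ^ 2 := by
  have h1 : fderiv ℝ (fun y => u y - ε * ‖y‖ ^ 2)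
      =ᶠ[𝓝 x] fun y => fderiv ℝ u y - (2 * ε) • innerSL ℝ y := by
    filter_upwards [hu.eventually_differentiableAt_two] with y hy
    have h := hy.hasFDerivAt.sub ((hasStrictFDerivAt_norm_sq y).hasFDerivAt.const_mul ε)
    rw [show fderiv ℝ (fun y => u y - ε * ‖y‖ ^ 2) y = _ from h.fderiv]
    ext v
    simp
    ring
  have h2 := hu.hasFDerivAt_fderiv.sub
    ((innerSL ℝ : E →L[ℝ] E →L[ℝ] ℝ).hasFDerivAt.const_smul (2 * ε) (x := x))
  have h3 : hess (fun y => u y - ε * ‖y‖ ^ 2) x = _ := h1.fderiv_eq.trans h2.fderiv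
  rw [h3]
  rw [sub_apply, sub_apply, smul_apply, smul_apply, innerSL_apply_apply,
    real_inner_self_eq_norm_sq, smul_eq_mul]

end

/-! ### Quasi-concavity of the potential of a convex ring -/

section

variable {E : Type*} [NormedAddCommGroup E] [InnerProductSpace ℝ E]

/-- The capacitary potential of a ring `Ω₀ \ closure Ω₁` between two regions with strictly convex
closures, continued by `1` over the hole. -/
structure IsRingPotential [FiniteDimensional ℝ E] (Ω₀ Ω₁ : Set E) (U : E → ℝ) : Prop where
  isOpen_outer : IsOpen Ω₀
  isOpen_inner : IsOpen Ω₁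
  isBounded_outer : Bornology.IsBounded Ω₀
  closure_inner_subset : closure Ω₁ ⊆ Ω₀
  strictConvex_outer : StrictConvex ℝ (closure Ω₀)
  strictConvex_inner : StrictConvex ℝ (closure Ω₁)
  interior_closure_outer : interior (closure Ω₀) = Ω₀
  interior_closure_inner : interior (closure Ω₁) = Ω₁
  continuousOn : ContinuousOn U (closure Ω₀)
  eq_zero : ∀ x ∈ frontier Ω₀, U x = 0
  eq_one : ∀ x ∈ closure Ω₁, U x = 1
  pos : ∀ x ∈ Ω₀ \ closure Ω₁, 0 < U x
  lt_one : ∀ x ∈ Ω₀ \ closure Ω₁, U x < 1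
  harmonicAt : ∀ x ∈ Ω₀ \ closure Ω₁, InnerProductSpace.HarmonicAt U x
  gradient_ne_zero : ∀ x ∈ Ω₀ \ closure Ω₁, gradient U x ≠ 0

lemma Convex.half_smul_add_mem {s : Set E} (hs : Convex ℝ s) {x y : E} (hx : x ∈ s) (hy : y ∈ s) :
    (1 / 2 : ℝ) • (x + y) ∈ s := by
  rw [smul_add]
  exact hs hx hy (by norm_num) (by norm_num) (by norm_num)

lemma StrictConvex.half_smul_add_mem {s : Set E} (hs : StrictConvex ℝ s) {x y : E} (hx : x ∈ s)
    (hy : y ∈ s) (hxy : x ≠ y) : (1 / 2 : ℝ) • (x + y) ∈ interior s := by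
  rw [smul_add]
  exact hs hx hy hxy (by norm_num) (by norm_num) (by norm_num)

/-- At a two-point minimum where `u x` exceeds `u y`, the point `x` is unconstrained. -/
lemma twoPoint_min_conditions_of_lt [CompleteSpace E] {u f T : E → ℝ} {x y : E}
    (hf : DifferentiableAt ℝ f ((1 / 2 : ℝ) • (x + y))) (hT : DifferentiableAt ℝ T (x - y))
    (hux : ContinuousAt u x) (huy : DifferentiableAt ℝ u y) (hxy : u y < u x)
    (hmin : ∀ᶠ q : E × E in 𝓝 (x, y),
      f ((1 / 2 : ℝ) • (x + y)) - T (x - y) - min (u x) (u y) ≤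
        f ((1 / 2 : ℝ) • (q.1 + q.2)) - T (q.1 - q.2) - min (u q.1) (u q.2)) :
    (1 / 2 : ℝ) • gradient f ((1 / 2 : ℝ) • (x + y)) = gradient T (x - y) ∧
      (1 / 2 : ℝ) • gradient f ((1 / 2 : ℝ) • (x + y)) + gradient T (x - y) = gradient u y := by
  have hlt : ∀ᶠ q : E × E in 𝓝 (x, y), u q.2 < u q.1 := by
    have h1 : ContinuousAt (fun q : E × E => u q.2) (x, y) :=
      ContinuousAt.comp (f := Prod.snd) huy.continuousAt continuousAt_snd
    have h2 : ContinuousAt (fun q : E × E => u q.1) (x, y) :=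
      ContinuousAt.comp (f := Prod.fst) hux continuousAt_fst
    exact h1.eventually_lt h2 hxy
  have hmin' : ∀ᶠ q : E × E in 𝓝 (x, y),
      f ((1 / 2 : ℝ) • (x + y)) - T (x - y) - u y ≤
        f ((1 / 2 : ℝ) • (q.1 + q.2)) - T (q.1 - q.2) - u q.2 := by
    filter_upwards [hmin, hlt] with q h1 h2
    rwa [min_eq_right hxy.le, min_eq_right h2.le] at h1
  have hx : IsLocalMin (fun a => f ((1 / 2 : ℝ) • (a + y)) - T (a - y) - u y) x :=
    (show Continuous fun a : E => (a, y) by fun_prop).tendsto x |>.eventually hmin'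
  have hy : IsLocalMin (fun b => f ((1 / 2 : ℝ) • (x + b)) - T (x - b) - u b) y :=
    (show Continuous fun b : E => (x, b) by fun_prop).tendsto y |>.eventually hmin'
  have dx : HasFDerivAt (fun a => f ((1 / 2 : ℝ) • (a + y)) - T (a - y) - u y) _ x :=
    ((hf.hasFDerivAt.comp x (((hasFDerivAt_id x).add_const y).const_smul (1 / 2 : ℝ))).sub
      (hT.hasFDerivAt.comp x ((hasFDerivAt_id x).sub_const y))).sub_const (u y)
  have dy : HasFDerivAt (fun b => f ((1 / 2 : ℝ) • (x + b)) - T (x - b) - u b) _ y :=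
    ((hf.hasFDerivAt.comp y (((hasFDerivAt_id y).const_add x).const_smul (1 / 2 : ℝ))).sub
      (hT.hasFDerivAt.comp y ((hasFDerivAt_id y).const_sub x))).sub huy.hasFDerivAt
  have ex := hx.hasFDerivAt_eq_zero dx
  have ey := hy.hasFDerivAt_eq_zero dy
  constructor <;> refine ext_inner_right ℝ fun v => ?_
  · have := congrArg (fun L => L v) ex
    simp at this
    simp [inner_smul_left]
    linarith
  · have := congrArg (fun L => L v) ey
    simp at this
    simp [inner_smul_left, inner_add_left]
    linarith

/-- Infinitesimal consequence of a penalized midpoint inequality. -/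
lemma hess_le_of_midpoint {u : E → ℝ} {z v : E} {k r : ℝ} (hr : 0 < r) (hu : ContDiffAt ℝ 2 u z)
    (hv : fderiv ℝ u z v = 0)
    (h : ∀ᶠ t : ℝ in 𝓝 0,
      min (u (z + t • v)) (u (z + t • (-v))) + penalty k r ((2 * t) • v) ≤ u z) :
    hess u z v v ≤ -(4 * k * ‖v‖ ^ 2) := by
  by_contra hneg
  push Not at hneg
  have hpen : HasSecondOrderExpansion (fun t : ℝ => penalty k r ((2 * t) • v)) 0 0
      (4 * k * ‖v‖ ^ 2) := by
    have h1 := (contDiff_penalty (E := E) (k := k) hr).contDiffAt.hasSecondOrderExpansion_line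
      (x := 0) ((2 : ℝ) • v)
    rw [hess_penalty_zero hr, penalty_zero hr, fderiv_penalty hr] at h1
    convert h1 using 1
    · funext t; rw [zero_add, smul_smul, mul_comm]
    · simp
    · rw [norm_smul]; norm_num; ring
  have h1 := (hu.hasSecondOrderExpansion_line v).add hpen
  have h2 := (hu.hasSecondOrderExpansion_line (-v)).add hpen
  simp only [map_neg, neg_apply, neg_neg, hv, neg_zero, add_zero] at h1 h2
  obtain ⟨t, ht, ht1, ht2⟩ := ((h.filter_mono nhdsWithin_le_nhds).and
    ((h1.eventually_gt (by linarith)).and (h2.eventually_gt (by linarith)))).exists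
  rcases min_choice (u (z + t • v)) (u (z + t • (-v))) with h | h <;> rw [h] at ht <;> linarith

namespace IsRingPotential

variable [FiniteDimensional ℝ E] {Ω₀ Ω₁ : Set E} {U : E → ℝ}

lemma isOpen_ring (h : IsRingPotential Ω₀ Ω₁ U) : IsOpen (Ω₀ \ closure Ω₁) :=
  h.isOpen_outer.sdiff isClosed_closure

lemma isCompact_closure (h : IsRingPotential Ω₀ Ω₁ U) : IsCompact (closure Ω₀) :=
  h.isBounded_outer.isCompact_closure

lemma continuousAt (h : IsRingPotential Ω₀ Ω₁ U) {x : E} (hx : x ∈ Ω₀) : ContinuousAt U x :=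
  h.continuousOn.continuousAt (mem_of_superset (h.isOpen_outer.mem_nhds hx) subset_closure)

lemma mem_outer_of_ne_zero (h : IsRingPotential Ω₀ Ω₁ U) {x : E} (hx : x ∈ closure Ω₀)
    (hU : U x ≠ 0) : x ∈ Ω₀ := by
  by_contra hx'
  exact hU (h.eq_zero x ⟨hx, fun hi => hx' (interior_subset hi)⟩)

lemma le_one (h : IsRingPotential Ω₀ Ω₁ U) {x : E} (hx : x ∈ closure Ω₀) : U x ≤ 1 := by
  by_cases h1 : x ∈ closure Ω₁
  · exact (h.eq_one x h1).le
  by_cases h0 : U x = 0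
  · rw [h0]; exact zero_le_one
  exact (h.lt_one x ⟨h.mem_outer_of_ne_zero hx h0, h1⟩).le

lemma nonneg (h : IsRingPotential Ω₀ Ω₁ U) {x : E} (hx : x ∈ closure Ω₀) : 0 ≤ U x := by
  by_cases h1 : x ∈ closure Ω₁
  · rw [h.eq_one x h1]; exact zero_le_one
  by_cases h0 : U x = 0
  · exact h0.ge
  exact (h.pos x ⟨h.mem_outer_of_ne_zero hx h0, h1⟩).le

lemma pos_of_mem (h : IsRingPotential Ω₀ Ω₁ U) {x : E} (hx : x ∈ Ω₀) : 0 < U x := by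
  by_cases h1 : x ∈ closure Ω₁
  · rw [h.eq_one x h1]; exact zero_lt_one
  exact h.pos x ⟨hx, h1⟩

lemma mem_ring_of_lt_one (h : IsRingPotential Ω₀ Ω₁ U) {x : E} (hx : x ∈ Ω₀) (hU : U x < 1) :
    x ∈ Ω₀ \ closure Ω₁ :=
  ⟨hx, fun h1 => hU.ne (h.eq_one x h1)⟩

/-- A pair at the same level with midpoint in the ring lies in the ring. -/
lemma mem_ring_of_eq (h : IsRingPotential Ω₀ Ω₁ U) {x y : E} (hx : x ∈ Ω₀) (hy : y ∈ Ω₀)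
    (hz : (1 / 2 : ℝ) • (x + y) ∉ closure Ω₁) (hxy : U x = U y) :
    x ∈ Ω₀ \ closure Ω₁ ∧ y ∈ Ω₀ \ closure Ω₁ := by
  by_cases h1 : x ∈ closure Ω₁
  · by_cases h2 : y ∈ closure Ω₁
    · exact absurd (h.strictConvex_inner.convex.half_smul_add_mem h1 h2) hz
    · have := h.lt_one y ⟨hy, h2⟩
      rw [h.eq_one x h1] at hxy; linarith
  · by_cases h2 : y ∈ closure Ω₁
    · have := h.lt_one x ⟨hx, h1⟩
      rw [h.eq_one y h2] at hxy; linarith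
    · exact ⟨⟨hx, h1⟩, ⟨hy, h2⟩⟩

/-- The perturbed midpoint function `U - ε |·|²` has no interior two-point minimum. -/
lemma not_local_min_perturbed (h : IsRingPotential Ω₀ Ω₁ U) (hdim : 0 < Module.finrank ℝ E)
    {ε : ℝ} (hε : 0 < ε) {x y : E}
    (hx : x ∈ Ω₀) (hy : y ∈ Ω₀) (hz : (1 / 2 : ℝ) • (x + y) ∈ Ω₀ \ closure Ω₁)
    (hmin : ∀ᶠ q : E × E in 𝓝 (x, y),
      (U ((1 / 2 : ℝ) • (x + y)) - ε * ‖(1 / 2 : ℝ) • (x + y)‖ ^ 2) - min (U x) (U y) ≤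
        (U ((1 / 2 : ℝ) • (q.1 + q.2)) - ε * ‖(1 / 2 : ℝ) • (q.1 + q.2)‖ ^ 2)
          - min (U q.1) (U q.2)) : False := by
  wlog hle : U y ≤ U x generalizing x y
  · refine this hy hx (by rwa [add_comm]) ?_ (le_of_not_ge hle)
    have := (continuous_swap.tendsto (y, x)).eventually hmin
    filter_upwards [this] with q hq
    simpa [add_comm, min_comm] using hq
  set f : E → ℝ := fun w => U w - ε * ‖w‖ ^ 2 with hf
  set T : E → ℝ := fun _ => 0 with hT
  have hUz := (h.harmonicAt _ hz).1
  have hfz : ContDiffAt ℝ 2 f ((1 / 2 : ℝ) • (x + y)) :=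
    hUz.sub (contDiffAt_const.mul (contDiff_norm_sq ℝ).contDiffAt)
  have hTz : ContDiffAt ℝ 2 T (x - y) := contDiffAt_const
  have hgT : gradient T (x - y) = 0 := gradient_const (x - y) (0 : ℝ)
  rcases hle.lt_or_eq with hlt | heq
  · have hy1 := h.mem_ring_of_lt_one hy (hlt.trans_le (h.le_one (subset_closure hx)))
    obtain ⟨h1, h2⟩ := twoPoint_min_conditions_of_lt (f := f) (T := T) (u := U)
      (hfz.differentiableAt (by simp)) (hTz.differentiableAt (by simp)) (h.continuousAt hx)
      ((h.harmonicAt y hy1).1.differentiableAt (by simp)) hlt (by simpa [hf, hT] using hmin)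
    rw [h1, hgT, add_zero] at h2
    exact h.gradient_ne_zero y hy1 h2.symm
  · obtain ⟨hx1, hy1⟩ := h.mem_ring_of_eq hx hy hz.2 heq.symm
    obtain ⟨l, -, -, h1, h2, h3⟩ := twoPoint_min_conditions (f := f) (T := T) (u := U)
      (h.harmonicAt x hx1).1 (h.harmonicAt y hy1).1 hfz hTz heq.symm
      (h.gradient_ne_zero x hx1) (h.gradient_ne_zero y hy1)
      (by simpa [hf, hT, heq] using hmin)
    rw [hgT] at h1 h2
    have hh : hess T (x - y) = 0 := by
      have : fderiv ℝ T = fun _ => 0 := by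
        funext w; exact (hasFDerivAt_const (0 : ℝ) w).fderiv
      rw [hess, this]
      exact (hasFDerivAt_const (0 : E →L[ℝ] ℝ) (x - y)).fderiv
    refine false_of_parallel_second_order (l := l)
      (by rw [← h1, ← h2]; simp) (stdOrthonormalBasis ℝ E)
      ((h.harmonicAt x hx1).sum_hess_eq_zero _) ((h.harmonicAt y hy1).sum_hess_eq_zero _)
      (Hz := hess f ((1 / 2 : ℝ) • (x + y))) ?_ fun v w hvw => ?_
    · have : ∀ i, hess f ((1 / 2 : ℝ) • (x + y)) (stdOrthonormalBasis ℝ E i)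
          (stdOrthonormalBasis ℝ E i) = hess U ((1 / 2 : ℝ) • (x + y))
            (stdOrthonormalBasis ℝ E i) (stdOrthonormalBasis ℝ E i) - 2 * ε := fun i => by
        rw [hess_sub_norm_sq hUz]; simp
      simp_rw [this]
      rw [Finset.sum_sub_distrib, (h.harmonicAt _ hz).sum_hess_eq_zero]
      simp
      positivity
    · simpa [hh] using h3 v w hvw

/-- Gabriel's theorem: the potential of a convex ring is (midpoint) quasi-concave. -/
theorem min_le_midpoint (h : IsRingPotential Ω₀ Ω₁ U) (hdim : 0 < Module.finrank ℝ E) {x y : E}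
    (hx : x ∈ closure Ω₀) (hy : y ∈ closure Ω₀) :
    min (U x) (U y) ≤ U ((1 / 2 : ℝ) • (x + y)) := by
  by_contra hneg
  push Not at hneg
  have hmid : ∀ q ∈ closure Ω₀ ×ˢ closure Ω₀, (1 / 2 : ℝ) • (q.1 + q.2) ∈ closure Ω₀ :=
    fun q hq => h.strictConvex_outer.convex.half_smul_add_mem hq.1 hq.2
  obtain ⟨R, hR⟩ := h.isCompact_closure.isBounded.exists_norm_le
  set m := min (U x) (U y) - U ((1 / 2 : ℝ) • (x + y)) with hm
  have hm0 : 0 < m := sub_pos.2 hneg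
  set ε := m / (2 * (R ^ 2 + 1)) with hε
  have hε0 : 0 < ε := by positivity
  have hεR : ∀ z ∈ closure Ω₀, ε * ‖z‖ ^ 2 ≤ m / 2 := fun z hz => by
    have h1 : ‖z‖ ^ 2 ≤ R ^ 2 + 1 := by
      have := pow_le_pow_left₀ (norm_nonneg z) (hR z hz) 2
      linarith
    calc ε * ‖z‖ ^ 2 ≤ ε * (R ^ 2 + 1) := mul_le_mul_of_nonneg_left h1 hε0.le
      _ = m / 2 := by rw [hε]; field_simp
  set F : E × E → ℝ := fun q => (U ((1 / 2 : ℝ) • (q.1 + q.2))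
    - ε * ‖(1 / 2 : ℝ) • (q.1 + q.2)‖ ^ 2) - min (U q.1) (U q.2) with hF
  have hFc : ContinuousOn F (closure Ω₀ ×ˢ closure Ω₀) := by
    refine ((h.continuousOn.comp (by fun_prop) hmid).sub (by fun_prop)).sub ?_
    exact ContinuousOn.inf (h.continuousOn.comp continuousOn_fst fun q hq => hq.1)
      (h.continuousOn.comp continuousOn_snd fun q hq => hq.2)
  obtain ⟨⟨a, b⟩, ⟨ha, hb⟩, hab⟩ := (h.isCompact_closure.prod h.isCompact_closure).exists_isMinOn
    ⟨(x, y), hx, hy⟩ hFc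
  simp only at ha hb
  have hFab : F (a, b) ≤ F (x, y) := hab (show (x, y) ∈ closure Ω₀ ×ˢ closure Ω₀ from ⟨hx, hy⟩)
  have hz := hmid (a, b) ⟨ha, hb⟩
  simp only at hz
  have hFxy : F (x, y) ≤ -m := by
    have : 0 ≤ ε * ‖(1 / 2 : ℝ) • (x + y)‖ ^ 2 := by positivity
    simp only [hF, hm]; linarith
  have hgap : U ((1 / 2 : ℝ) • (a + b)) < min (U a) (U b) := by
    have := hεR _ hz
    simp only [hF] at hFab hFxy
    linarith
  have hgapa := hgap.trans_le (min_le_left _ _)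
  have hgapb := hgap.trans_le (min_le_right _ _)
  have hz0 := h.nonneg hz
  have hne : a ≠ b := by
    rintro rfl
    rw [← two_smul ℝ a, smul_smul] at hgapa
    norm_num at hgapa
  have hz1 : (1 / 2 : ℝ) • (a + b) ∈ Ω₀ := by
    have := h.strictConvex_outer.half_smul_add_mem ha hb hne
    rwa [h.interior_closure_outer] at this
  have ha1 := h.mem_outer_of_ne_zero ha (by linarith)
  have hb1 := h.mem_outer_of_ne_zero hb (by linarith)
  refine h.not_local_min_perturbed hdim hε0 ha1 hb1
    (h.mem_ring_of_lt_one hz1 (hgapa.trans_le (h.le_one ha))) ?_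
  filter_upwards [(h.isOpen_outer.prod h.isOpen_outer).mem_nhds
    (show (a, b) ∈ Ω₀ ×ˢ Ω₀ from ⟨ha1, hb1⟩)] with q hq
  exact hab (show q ∈ closure Ω₀ ×ˢ closure Ω₀ from
    ⟨subset_closure hq.1, subset_closure hq.2⟩)

/-- The Hessian of the potential is nonpositive along the level sets. -/
lemma hess_nonpos (h : IsRingPotential Ω₀ Ω₁ U) (hdim : 0 < Module.finrank ℝ E) {z v : E}
    (hz : z ∈ Ω₀ \ closure Ω₁) (hv : inner ℝ (gradient U z) v = 0) : hess U z v v ≤ 0 := by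
  have key := hess_le_of_midpoint (k := 0) (r := 1) one_pos (h.harmonicAt z hz).1
    (by simpa using hv) (by
      have h1 : ∀ w : E, ∀ᶠ t : ℝ in 𝓝 0, z + t • w ∈ Ω₀ := fun w => by
        have : Continuous fun t : ℝ => z + t • w := by fun_prop
        refine this.continuousAt.eventually_mem (h.isOpen_outer.mem_nhds ?_)
        simpa using hz.1
      filter_upwards [h1 v, h1 (-v)] with t h1 h2
      have := h.min_le_midpoint hdim (subset_closure h1) (subset_closure h2)
      have e : (1 / 2 : ℝ) • (z + t • v + (z + t • (-v))) = z := by module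
      rw [e] at this
      simpa [penalty] using this)
  simpa using key

end IsRingPotential

end

/-! ### The penalized midpoint inequality -/

section

variable {E : Type*} [NormedAddCommGroup E] [InnerProductSpace ℝ E] [FiniteDimensional ℝ E]
  {Ω₀ Ω₁ : Set E} {U : E → ℝ}

namespace IsRingPotential

/-- Quasi-concavity forces `U` not to decrease, to first order, towards points of larger value. -/
lemma inner_gradient_nonneg (h : IsRingPotential Ω₀ Ω₁ U) (hdim : 0 < Module.finrank ℝ E)
    {x y : E} (hx : x ∈ Ω₀ \ closure Ω₁) (hy : y ∈ closure Ω₀) (hxy : U x ≤ U y) :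
    0 ≤ inner ℝ (gradient U x) (y - x) := by
  by_contra hneg
  push Not at hneg
  have hd : ∀ j : ℕ, x + ((1 / 2 : ℝ) ^ j) • (y - x) ∈ closure Ω₀ ∧
      U x ≤ U (x + ((1 / 2 : ℝ) ^ j) • (y - x)) := by
    intro j
    induction j with
    | zero => simpa using ⟨hy, hxy⟩
    | succ j ih =>
      have e : x + ((1 / 2 : ℝ) ^ (j + 1)) • (y - x)
          = (1 / 2 : ℝ) • (x + (x + ((1 / 2 : ℝ) ^ j) • (y - x))) := by
        rw [pow_succ]; module
      rw [e]
      have hx' : x ∈ closure Ω₀ := subset_closure hx.1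
      refine ⟨h.strictConvex_outer.convex.half_smul_add_mem hx' ih.1, ?_⟩
      have := h.min_le_midpoint hdim hx' ih.1
      rwa [min_eq_left ih.2] at this
  have hlt := ((h.harmonicAt x hx).1.hasSecondOrderExpansion_line (y - x)).eventually_lt_of_neg
    (by simpa using hneg)
  have hlim : Tendsto (fun j : ℕ => (1 / 2 : ℝ) ^ j) atTop (𝓝[>] 0) :=
    tendsto_nhdsWithin_iff.2 ⟨tendsto_pow_atTop_nhds_zero_of_lt_one (by norm_num) (by norm_num),
      Eventually.of_forall fun j => by simp only [mem_Ioi]; positivity⟩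
  obtain ⟨j, hj⟩ := (hlim.eventually hlt).exists
  exact absurd (hd j).2 (not_le.2 hj)

/-- `U ((a + b) / 2) - min (U a) (U b) - penalty (a - b)` has no interior minimum off the
diagonal, provided the slope of the penalty is small compared with `|∇U|`. -/
lemma not_local_min_penalized (h : IsRingPotential Ω₀ Ω₁ U) (hdim : 2 ≤ Module.finrank ℝ E)
    {k r : ℝ} (hk : 0 < k) (hr : 0 < r) {x y : E} (hxy : x ≠ y)
    (hx : x ∈ Ω₀) (hy : y ∈ Ω₀) (hz : (1 / 2 : ℝ) • (x + y) ∈ Ω₀ \ closure Ω₁)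
    (hgrad : 2 * (k * r) < ‖gradient U ((1 / 2 : ℝ) • (x + y))‖)
    (hmin : ∀ᶠ q : E × E in 𝓝 (x, y),
      U ((1 / 2 : ℝ) • (x + y)) - penalty k r (x - y) - min (U x) (U y) ≤
        U ((1 / 2 : ℝ) • (q.1 + q.2)) - penalty k r (q.1 - q.2) - min (U q.1) (U q.2)) :
    False := by
  wlog hle : U y ≤ U x generalizing x y
  · refine this hxy.symm hy hx (by rwa [add_comm]) (by rwa [add_comm]) ?_ (le_of_not_ge hle)
    have := (continuous_swap.tendsto (y, x)).eventually hmin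
    filter_upwards [this] with q hq
    rw [← penalty_neg (y - x), ← penalty_neg (q.1 - q.2)]
    simpa [add_comm, min_comm] using hq
  have hUz := (h.harmonicAt _ hz).1
  have hTz : ContDiffAt ℝ 2 (penalty k r : E → ℝ) (x - y) := (contDiff_penalty hr).contDiffAt
  have hTle := norm_gradient_penalty_le hk.le hr (x - y)
  set G := gradient U ((1 / 2 : ℝ) • (x + y)) with hG
  rcases hle.lt_or_eq with hlt | heq
  · have hy1 := h.mem_ring_of_lt_one hy (hlt.trans_le (h.le_one (subset_closure hx)))
    obtain ⟨h1, -⟩ := twoPoint_min_conditions_of_lt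
      (hUz.differentiableAt (by simp)) (hTz.differentiableAt (by simp)) (h.continuousAt hx)
      ((h.harmonicAt y hy1).1.differentiableAt (by simp)) hlt hmin
    rw [← h1, ← hG, norm_smul] at hTle
    norm_num at hTle
    linarith
  · obtain ⟨hx1, hy1⟩ := h.mem_ring_of_eq hx hy hz.2 heq.symm
    obtain ⟨l, hl0, hl1, h1, h2, h3⟩ := twoPoint_min_conditions
      (h.harmonicAt x hx1).1 (h.harmonicAt y hy1).1 hUz hTz heq.symm
      (h.gradient_ne_zero x hx1) (h.gradient_ne_zero y hy1)
      (by simpa [heq] using hmin)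
    have hP0 := h.gradient_ne_zero x hx1
    have i1 := h.inner_gradient_nonneg (by omega) hx1 (subset_closure hy) heq.ge
    have i2 := h.inner_gradient_nonneg (by omega) hy1 (subset_closure hx) heq.le
    set P := gradient U x
    set R := gradient U y
    have hsum : G = l • P + (1 - l) • R := by rw [← h1, ← h2]; module
    have hdiff : (2 : ℝ) • gradient (penalty k r) (x - y) = (1 - l) • R - l • P := by
      rw [← h1, ← h2]; module
    refine false_of_independent_second_order (l := l) hdim hP0 ?_
      (h.harmonicAt x hx1).sum_hess_eq_zero (h.harmonicAt y hy1).sum_hess_eq_zero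
      (h.harmonicAt _ hz).sum_hess_eq_zero (fun v hv1 hv2 => ?_)
      (fun v hv => hess_penalty_pos hk hr (x - y) hv) h3
    · -- if `R = s P`, then `x - y` is parallel to `P`; the slope bound gives `s > 0`, and
      -- quasi-concavity along the segment from `x` to `y` is violated
      intro s hs
      rw [hs, smul_smul, ← sub_smul] at hdiff
      rw [hs, smul_smul, ← add_smul] at hsum
      have hPn : 0 < ‖P‖ := norm_pos_iff.2 hP0
      have n1 : |(1 - l) * s - l| * ‖P‖ ≤ 2 * (k * r) := by
        rw [← Real.norm_eq_abs, ← norm_smul, ← hdiff, norm_smul]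
        norm_num
        exact hTle
      have n2 : |l + (1 - l) * s| * ‖P‖ = ‖G‖ := by
        rw [hsum, norm_smul, Real.norm_eq_abs]
      have n3 : |(1 - l) * s - l| < |l + (1 - l) * s| :=
        lt_of_mul_lt_mul_right (by linarith) hPn.le
      have n4 := sq_lt_sq.2 n3
      have n5 : 0 < l * (1 - l) * s := by nlinarith
      have hs0 : 0 < s := by
        by_contra hs0
        push Not at hs0
        have : 0 ≤ l * (1 - l) := mul_nonneg hl0 (by linarith)
        nlinarith
      have hin : inner ℝ P (x - y) = 0 := by
        rw [hs, inner_smul_left] at i2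
        have i2' : 0 ≤ inner ℝ P (x - y) := by
          simp only [RCLike.conj_to_real] at i2
          exact nonneg_of_mul_nonneg_right i2 hs0
        rw [← neg_sub, inner_neg_right] at i1
        linarith
      have hinT := congrArg (fun v => inner ℝ v (x - y)) hdiff
      simp only [gradient_penalty hr, inner_smul_left, RCLike.conj_to_real, hin, mul_zero] at hinT
      have hS : 0 < Real.sqrt (‖x - y‖ ^ 2 + r ^ 2) := by positivity
      have hpos : 0 < inner ℝ (x - y) (x - y) := real_inner_self_pos.2 (sub_ne_zero.2 hxy)
      have : 0 < 2 * (k * r * (Real.sqrt (‖x - y‖ ^ 2 + r ^ 2))⁻¹ * inner ℝ (x - y) (x - y)) := by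
        positivity
      linarith
    · refine h.hess_nonpos (by omega) hz ?_
      rw [← hG, hsum, inner_add_left, inner_smul_left, inner_smul_left, hv1, hv2]
      simp

/-- Midpoint inequality with a penalty, derived from its validity when an endpoint is on the outer
boundary or the midpoint is on the inner boundary. -/
theorem min_add_penalty_le_midpoint (h : IsRingPotential Ω₀ Ω₁ U)
    (hdim : 2 ≤ Module.finrank ℝ E) {k r : ℝ} (hk : 0 < k) (hr : 0 < r)
    (hgrad : ∀ z ∈ Ω₀ \ closure Ω₁, 2 * (k * r) < ‖gradient U z‖)
    (houter : ∀ x ∈ frontier Ω₀, ∀ y ∈ closure Ω₀,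
      penalty k r (x - y) ≤ U ((1 / 2 : ℝ) • (x + y)))
    (hinner : ∀ x ∈ closure Ω₀, ∀ y ∈ closure Ω₀, (1 / 2 : ℝ) • (x + y) ∈ frontier Ω₁ →
      min (U x) (U y) + penalty k r (x - y) ≤ 1)
    {x y : E} (hx : x ∈ closure Ω₀) (hy : y ∈ closure Ω₀)
    (hxy : (1 / 2 : ℝ) • (x + y) ∉ Ω₁) :
    min (U x) (U y) + penalty k r (x - y) ≤ U ((1 / 2 : ℝ) • (x + y)) := by
  by_contra hneg
  push Not at hneg
  set F : E × E → ℝ := fun q => U ((1 / 2 : ℝ) • (q.1 + q.2)) - penalty k r (q.1 - q.2)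
    - min (U q.1) (U q.2) with hF
  have hmid : ∀ q ∈ closure Ω₀ ×ˢ closure Ω₀, (1 / 2 : ℝ) • (q.1 + q.2) ∈ closure Ω₀ :=
    fun q hq => h.strictConvex_outer.convex.half_smul_add_mem hq.1 hq.2
  have hFc : ContinuousOn F (closure Ω₀ ×ˢ closure Ω₀) := by
    refine ((h.continuousOn.comp (by fun_prop) hmid).sub
      (((contDiff_penalty hr).continuous.comp (by fun_prop)).continuousOn)).sub ?_
    exact ContinuousOn.inf (h.continuousOn.comp continuousOn_fst fun q hq => hq.1)
      (h.continuousOn.comp continuousOn_snd fun q hq => hq.2)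
  set K : Set (E × E) := (closure Ω₀ ×ˢ closure Ω₀) ∩ {q | (1 / 2 : ℝ) • (q.1 + q.2) ∉ Ω₁}
    with hK
  have hKc : IsCompact K := by
    refine (h.isCompact_closure.prod h.isCompact_closure).inter_right ?_
    exact h.isOpen_inner.isClosed_compl.preimage
      (by fun_prop : Continuous fun q : E × E => (1 / 2 : ℝ) • (q.1 + q.2))
  obtain ⟨⟨a, b⟩, ⟨⟨ha, hb⟩, habz⟩, hab⟩ := hKc.exists_isMinOn ⟨(x, y), ⟨hx, hy⟩, hxy⟩
    (hFc.mono inter_subset_left)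
  simp only [mem_ofPred_eq] at ha hb habz
  have hFab : F (a, b) ≤ F (x, y) := hab (show (x, y) ∈ K from ⟨⟨hx, hy⟩, hxy⟩)
  have hgap : U ((1 / 2 : ℝ) • (a + b)) < min (U a) (U b) + penalty k r (a - b) := by
    simp only [hF] at hFab; linarith
  have hz := hmid (a, b) ⟨ha, hb⟩
  simp only at hz
  have hne : a ≠ b := by
    rintro rfl
    rw [← two_smul ℝ a, smul_smul, sub_self, penalty_zero hr] at hgap
    norm_num at hgap
  have ha1 : a ∈ Ω₀ := by
    by_contra ha1
    have ha2 : a ∈ frontier Ω₀ := ⟨ha, fun hi => ha1 (interior_subset hi)⟩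
    have := houter a ha2 b hb
    have := min_le_left (U a) (U b)
    rw [h.eq_zero a ha2] at this
    rw [h.eq_zero a ha2] at hgap
    linarith
  have hb1 : b ∈ Ω₀ := by
    by_contra hb1
    have hb2 : b ∈ frontier Ω₀ := ⟨hb, fun hi => hb1 (interior_subset hi)⟩
    have := houter b hb2 a ha
    rw [← penalty_neg, neg_sub, add_comm b a] at this
    have := min_le_right (U a) (U b)
    rw [h.eq_zero b hb2] at this
    rw [h.eq_zero b hb2] at hgap
    linarith
  have hz1 : (1 / 2 : ℝ) • (a + b) ∈ Ω₀ := by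
    have := h.strictConvex_outer.half_smul_add_mem ha hb hne
    rwa [h.interior_closure_outer] at this
  have hz2 : (1 / 2 : ℝ) • (a + b) ∈ Ω₀ \ closure Ω₁ := by
    refine ⟨hz1, fun hc => ?_⟩
    have := hinner a ha b hb ⟨hc, fun hi => habz (interior_subset hi)⟩
    rw [h.eq_one _ hc] at hgap
    linarith
  refine h.not_local_min_penalized hdim hk hr hne ha1 hb1 hz2 (hgrad _ hz2) ?_
  have hmidc : Continuous fun q : E × E => (1 / 2 : ℝ) • (q.1 + q.2) := by fun_prop
  filter_upwards [(h.isOpen_outer.prod h.isOpen_outer).mem_nhds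
    (show (a, b) ∈ Ω₀ ×ˢ Ω₀ from ⟨ha1, hb1⟩),
    hmidc.continuousAt.eventually_mem (h.isOpen_ring.mem_nhds hz2)] with q hq hq2
  exact hab (show q ∈ K from ⟨⟨subset_closure hq.1, subset_closure hq.2⟩,
    fun hi => hq2.2 (subset_closure hi)⟩)

end IsRingPotential

end

/-! ### Principal curvatures through the Hessian of a defining function -/

section

variable {n : ℕ} {D : Set (EuclideanSpace ℝ (Fin n))} {p : EuclideanSpace ℝ (Fin n)}
  {ρ σ : EuclideanSpace ℝ (Fin n) → ℝ}

lemma hasFDerivAt_gradient {E : Type*} [NormedAddCommGroup E] [InnerProductSpace ℝ E]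
    [CompleteSpace E] {f : E → ℝ} {x : E} (hf : ContDiffAt ℝ 2 f x) :
    ∃ A : E →L[ℝ] E, HasFDerivAt (gradient f) A x ∧ ∀ v w, inner ℝ (A v) w = hess f x v w := by
  set J : StrongDual ℝ E →L[ℝ] E := AddMonoidHom.toRealLinearMap
    (InnerProductSpace.toDual ℝ E).symm.toLinearEquiv.toAddEquiv.toAddMonoidHom
    (InnerProductSpace.toDual ℝ E).symm.continuous with hJ
  refine ⟨J.comp (hess f x), J.hasFDerivAt.comp x hf.hasFDerivAt_fderiv, fun v w => ?_⟩
  exact InnerProductSpace.toDual_symm_apply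

namespace IsC2DefiningFunction

/-- The shape operator is tangential, and its quadratic form is `D²ρ / |∇ρ|`. -/
lemma fderiv_unitNormal (h : IsC2DefiningFunction ρ D p) (v : EuclideanSpace ℝ (Fin n)) :
    inner ℝ (gradient ρ p) (fderiv ℝ (unitNormal ρ) p v) = 0 ∧
      ∀ w, inner ℝ (gradient ρ p) w = 0 →
        inner ℝ (fderiv ℝ (unitNormal ρ) p v) w = ‖gradient ρ p‖⁻¹ * hess ρ p v w := by
  obtain ⟨A, hA, hAi⟩ := hasFDerivAt_gradient h.contDiffAt
  have hg : 0 < ‖gradient ρ p‖ := norm_pos_iff.2 h.gradient_ne_zero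
  have hφ : DifferentiableAt ℝ (fun x => ‖gradient ρ x‖⁻¹) p :=
    (hA.differentiableAt.norm ℝ h.gradient_ne_zero).inv hg.ne'
  have hN : HasFDerivAt (unitNormal ρ) _ p := hφ.hasFDerivAt.smul hA
  constructor
  · have hone : (fun x => inner ℝ (unitNormal ρ x) (unitNormal ρ x)) =ᶠ[𝓝 p] fun _ => (1 : ℝ) := by
      filter_upwards [hA.continuousAt.eventually_ne h.gradient_ne_zero] with x hx
      have hx' : 0 < ‖gradient ρ x‖ := norm_pos_iff.2 hx
      rw [unitNormal, inner_smul_left, inner_smul_right, real_inner_self_eq_norm_sq]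
      simp only [RCLike.conj_to_real]
      field_simp
    have h1 := (hN.inner ℝ hN).fderiv
    rw [hone.fderiv_eq, fderiv_const_apply] at h1
    have h2 := congrArg (fun L => L v) h1
    rw [hN.fderiv]
    simp only [zero_apply, ContinuousLinearMap.comp_apply,
      ContinuousLinearMap.prod_apply, fderivInnerCLM_apply] at h2
    rw [real_inner_comm, ← two_mul] at h2
    have h3 := (mul_eq_zero.1 h2.symm).resolve_left two_ne_zero
    rw [unitNormal, real_inner_comm, inner_smul_left] at h3
    exact (mul_eq_zero.1 h3).resolve_left (by simpa using h.gradient_ne_zero)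
  · intro w hw
    rw [hN.fderiv]
    simp [inner_add_left, inner_smul_left, hAi, hw, -inner_gradient_left]

lemma hasSecondOrderExpansion (h : IsC2DefiningFunction ρ D p) (v q : EuclideanSpace ℝ (Fin n)) :
    HasSecondOrderExpansion (fun t => ρ (p + t • v + t ^ 2 • q)) 0 (inner ℝ (gradient ρ p) v)
      (hess ρ p v v + 2 * inner ℝ (gradient ρ p) q) := by
  have := h.contDiffAt.hasSecondOrderExpansion v q
  rw [h.eq_zero] at this
  simpa using this

/-- Two defining functions of the same set have the same sign along curves issuing from `p`. -/
lemma eventually_neg_iff (h : IsC2DefiningFunction ρ D p) (h' : IsC2DefiningFunction σ D p)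
    (v q : EuclideanSpace ℝ (Fin n)) :
    ∀ᶠ t : ℝ in 𝓝 0, ρ (p + t • v + t ^ 2 • q) < 0 ↔ σ (p + t • v + t ^ 2 • q) < 0 := by
  filter_upwards [(tendsto_parabola p v q).eventually (h.mem_iff.and h'.mem_iff)] with t ht
  rw [← ht.1, ht.2]

/-- The normal direction does not depend on the defining function. -/
lemma exists_gradient_eq_smul (h : IsC2DefiningFunction ρ D p) (h' : IsC2DefiningFunction σ D p) :
    ∃ s : ℝ, 0 < s ∧ gradient σ p = s • gradient ρ p := by
  obtain ⟨l, hl0, hl1, hl⟩ := exists_convex_comb_eq_zero (a := gradient ρ p) (b := -gradient σ p)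
    (fun v h1 h2 => by
      rw [inner_neg_left, neg_lt_zero] at h2
      have e1 := (h.hasSecondOrderExpansion v 0).eventually_lt_of_neg h1
      have e2 := ((h'.hasSecondOrderExpansion v 0).const_mul (-1)).eventually_lt_of_neg
        (by linarith)
      obtain ⟨t, ht, ht1, ht2⟩ := (((h.eventually_neg_iff h' v 0).filter_mono
        nhdsWithin_le_nhds).and (e1.and e2)).exists
      have := ht.1 ht1
      linarith)
  have hl0' : l ≠ 0 := by
    rintro rfl
    simp at hl
    exact h'.gradient_ne_zero hl
  have hl1' : 1 - l ≠ 0 := by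
    intro h0
    have : l = 1 := by linarith
    subst this
    simp at hl
    exact h.gradient_ne_zero hl
  have hl0'' : 0 < l := lt_of_le_of_ne hl0 (Ne.symm hl0')
  have hl1'' : 0 < 1 - l := lt_of_le_of_ne (by linarith) (Ne.symm hl1')
  refine ⟨l / (1 - l), by positivity, ?_⟩
  have h3 : (1 - l) • gradient σ p = l • gradient ρ p := by
    rw [← sub_eq_zero, ← neg_eq_zero, ← hl]; module
  rw [div_eq_inv_mul, mul_smul, ← h3, smul_smul, inv_mul_cancel₀ hl1', one_smul]

/-- The normalized second fundamental form does not depend on the defining function: otherwise a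
parabola tangent to the boundary would separate the two regions. -/
lemma hess_div_le (h : IsC2DefiningFunction ρ D p) (h' : IsC2DefiningFunction σ D p)
    {v : EuclideanSpace ℝ (Fin n)} (hv : inner ℝ (gradient ρ p) v = 0) :
    hess ρ p v v / ‖gradient ρ p‖ ≤ hess σ p v v / ‖gradient σ p‖ := by
  obtain ⟨s, hs0, hs⟩ := h.exists_gradient_eq_smul h'
  have hg : 0 < ‖gradient ρ p‖ := norm_pos_iff.2 h.gradient_ne_zero
  have hgs : ‖gradient σ p‖ = s * ‖gradient ρ p‖ := by
    rw [hs, norm_smul, Real.norm_of_nonneg hs0.le]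
  by_contra hlt
  push Not at hlt
  rw [hgs] at hlt
  obtain ⟨a, ha1, ha2⟩ := exists_between hlt
  rw [div_lt_iff₀ (by positivity)] at ha1
  rw [lt_div_iff₀ hg] at ha2
  set q := (-(a / (2 * ‖gradient ρ p‖))) • gradient ρ p with hq
  have hρq : 2 * inner ℝ (gradient ρ p) q = -(a * ‖gradient ρ p‖) := by
    rw [hq, inner_smul_right, real_inner_self_eq_norm_sq]; field_simp
  have hσq : 2 * inner ℝ (gradient σ p) q = -(a * (s * ‖gradient ρ p‖)) := by
    rw [hs, inner_smul_left, RCLike.conj_to_real]; linear_combination s * hρq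
  have e1 := h.hasSecondOrderExpansion v q
  have e2 := h'.hasSecondOrderExpansion v q
  rw [hv, hρq] at e1
  rw [hs, inner_smul_left, hv, mul_zero, ← hs, hσq] at e2
  obtain ⟨t, ht, ht1, ht2⟩ := (((h.eventually_neg_iff h' v q).filter_mono
    nhdsWithin_le_nhds).and ((e1.eventually_gt (by linarith)).and
      (e2.eventually_lt (by linarith)))).exists
  have := ht.2 ht2
  linarith

lemma hess_of_eigen (h : IsC2DefiningFunction ρ D p) {v : EuclideanSpace ℝ (Fin n)} {k : ℝ}
    (hv : inner ℝ (gradient ρ p) v = 0) (hk : fderiv ℝ (unitNormal ρ) p v = k • v) :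
    hess ρ p v v / ‖gradient ρ p‖ = k * ‖v‖ ^ 2 := by
  have := (h.fderiv_unitNormal v).2 v hv
  rw [hk, inner_smul_left, real_inner_self_eq_norm_sq] at this
  rw [div_eq_inv_mul, ← this]; rfl

/-- The smallest principal curvature is the minimum of `D²ρ(v, v) / |∇ρ|` over unit tangent
vectors `v`. -/
theorem smallestPrincipalCurvature_spec (hn : 2 ≤ n) (h : IsC2DefiningFunction ρ D p) :
    (∃ v, ‖v‖ = 1 ∧ inner ℝ (gradient ρ p) v = 0 ∧
      hess ρ p v v = smallestPrincipalCurvature D p * ‖gradient ρ p‖) ∧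
    ∀ v, inner ℝ (gradient ρ p) v = 0 →
      smallestPrincipalCurvature D p * ‖gradient ρ p‖ * ‖v‖ ^ 2 ≤ hess ρ p v v := by
  have hg : 0 < ‖gradient ρ p‖ := norm_pos_iff.2 h.gradient_ne_zero
  set S : Set (EuclideanSpace ℝ (Fin n)) :=
    Metric.sphere 0 1 ∩ {v | inner ℝ (gradient ρ p) v = 0} with hS
  have hScomp : IsCompact S := (isCompact_sphere _ _).inter_right
    (isClosed_eq (by fun_prop) continuous_const)
  have hSne : S.Nonempty := by
    obtain ⟨m, rfl⟩ := Nat.exists_eq_add_of_le' hn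
    obtain ⟨b, hb, -⟩ := exists_orthonormalBasis_adapted (m := m)
      (E := EuclideanSpace ℝ (Fin (m + 2))) (by simp) (gradient ρ p) 0
    refine ⟨b 1, by simp, ?_⟩
    change inner ℝ (gradient ρ p) (b 1) = 0
    rw [hb, inner_smul_left, orthonormal_iff_ite.1 b.orthonormal]
    simp
  obtain ⟨v₀, ⟨hv₀1, hv₀⟩, hmin⟩ := hScomp.exists_isMinOn hSne
    (f := fun v => hess ρ p v v) (by fun_prop)
  have hv₀1 : ‖v₀‖ = 1 := by simpa using hv₀1
  have hv₀ : inner ℝ (gradient ρ p) v₀ = 0 := hv₀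
  set μ := hess ρ p v₀ v₀ with hμ
  have hlow : ∀ v, inner ℝ (gradient ρ p) v = 0 → μ * ‖v‖ ^ 2 ≤ hess ρ p v v := by
    intro v hv
    by_cases hv0 : v = 0
    · simp [hv0]
    have hvn : 0 < ‖v‖ := norm_pos_iff.2 hv0
    have hmem : ‖v‖⁻¹ • v ∈ S := by
      refine ⟨?_, ?_⟩
      · rw [mem_sphere_zero_iff_norm, norm_smul, norm_inv, norm_norm, inv_mul_cancel₀ hvn.ne']
      · change inner ℝ (gradient ρ p) (‖v‖⁻¹ • v) = 0
        rw [inner_smul_right, hv, mul_zero]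
    have := hmin hmem
    simp only [mem_ofPred_eq, map_smul, smul_apply, smul_eq_mul] at this
    rw [← hμ, ← mul_assoc, ← sq, inv_pow, inv_mul_eq_div, le_div_iff₀ (by positivity)] at this
    exact this
  -- a minimizer is a critical point of the Rayleigh quotient
  have hcrit : ∀ w, inner ℝ (gradient ρ p) w = 0 → hess ρ p v₀ w = μ * inner ℝ v₀ w := by
    intro w hw
    have hquad : ∀ t : ℝ, 0 ≤ 2 * t * (hess ρ p v₀ w - μ * inner ℝ v₀ w)
        + t ^ 2 * (hess ρ p w w - μ * ‖w‖ ^ 2) := by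
      intro t
      have h1 := hlow (v₀ + t • w) (by rw [inner_add_right, inner_smul_right, hv₀, hw]; simp)
      rw [← real_inner_self_eq_norm_sq] at h1
      simp only [map_add, map_smul, add_apply, smul_apply, smul_eq_mul, inner_add_left,
        inner_add_right, inner_smul_left, inner_smul_right, RCLike.conj_to_real] at h1
      rw [hess_comm h.contDiffAt w v₀, ← hμ, real_inner_self_eq_norm_sq,
        real_inner_self_eq_norm_sq, hv₀1, real_inner_comm v₀ w] at h1
      linarith
    set B := hess ρ p v₀ w - μ * inner ℝ v₀ w with hB
    set C := hess ρ p w w - μ * ‖w‖ ^ 2 with hC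
    have hC0 : 0 ≤ C := by have := hlow w hw; linarith
    have hB0 : B ^ 2 ≤ 0 := by
      have h1 := hquad (-B / (C + 1))
      have h2 : 2 * (-B / (C + 1)) * B + (-B / (C + 1)) ^ 2 * C
          = -(B ^ 2 * (C + 2) / (C + 1) ^ 2) := by field_simp; ring
      rw [h2] at h1
      by_contra hB0
      push Not at hB0
      have : 0 < B ^ 2 * (C + 2) / (C + 1) ^ 2 := by positivity
      linarith
    have : B = 0 := by nlinarith
    linarith
  have heig : fderiv ℝ (unitNormal ρ) p v₀ = (μ / ‖gradient ρ p‖) • v₀ := by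
    rw [← sub_eq_zero, ← inner_self_eq_zero (𝕜 := ℝ)]
    set e := fderiv ℝ (unitNormal ρ) p v₀ - (μ / ‖gradient ρ p‖) • v₀ with he
    have hetan : inner ℝ (gradient ρ p) e = 0 := by
      rw [he, inner_sub_right, (h.fderiv_unitNormal v₀).1, inner_smul_right, hv₀]; simp
    nth_rewrite 1 [he]
    rw [inner_sub_left, (h.fderiv_unitNormal v₀).2 e hetan, hcrit e hetan, inner_smul_left]
    simp only [RCLike.conj_to_real]
    ring
  have hv₀0 : v₀ ≠ 0 := by intro h0; simp [h0] at hv₀1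
  have hleast : IsLeast (principalCurvatures D p) (μ / ‖gradient ρ p‖) := by
    refine ⟨⟨ρ, h, v₀, hv₀0, hv₀, heig⟩, ?_⟩
    rintro k ⟨σ, hσ, v, hv0, hv, hk⟩
    obtain ⟨s, hs0, hs⟩ := h.exists_gradient_eq_smul hσ
    have hv' : inner ℝ (gradient ρ p) v = 0 := by
      rw [hs, inner_smul_left] at hv
      exact (mul_eq_zero.1 hv).resolve_left (by simpa using hs0.ne')
    have h1 := h.hess_div_le hσ hv'
    rw [hσ.hess_of_eigen hv hk] at h1
    have h2 := div_le_div_of_nonneg_right (hlow v hv') hg.le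
    have hvn : 0 < ‖v‖ ^ 2 := by have := norm_pos_iff.2 hv0; positivity
    refine le_of_mul_le_mul_right ?_ hvn
    calc μ / ‖gradient ρ p‖ * ‖v‖ ^ 2 = μ * ‖v‖ ^ 2 / ‖gradient ρ p‖ := by ring
      _ ≤ _ := h2.trans h1
  have hκ : smallestPrincipalCurvature D p * ‖gradient ρ p‖ = μ := by
    rw [smallestPrincipalCurvature, hleast.csInf_eq, div_mul_cancel₀ _ hg.ne']
  rw [hκ]
  exact ⟨⟨v₀, hv₀1, hv₀, rfl⟩, hlow⟩

end IsC2DefiningFunction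

end

/-! ### Estimates near the boundary -/

section

/-- A `C²` function with Hessian above `K` at `p` is strongly midpoint convex near `p`. -/
lemma eventually_midpoint_le {E : Type*} [NormedAddCommGroup E] [InnerProductSpace ℝ E]
    [FiniteDimensional ℝ E] {σ : E → ℝ} {p : E} {K : ℝ}
    (hσ : ContDiffAt ℝ 2 σ p) (hK : ∀ v, v ≠ 0 → K * ‖v‖ ^ 2 < hess σ p v v) :
    ∀ᶠ q : E × E in 𝓝 (p, p), σ ((1 / 2 : ℝ) • (q.1 + q.2)) ≤
      1 / 2 * (σ q.1 + σ q.2) - K / 8 * ‖q.1 - q.2‖ ^ 2 := by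
  have hsphere : ∀ᶠ x in 𝓝 p, ∀ v ∈ Metric.sphere (0 : E) 1, K < hess σ x v v := by
    refine (isCompact_sphere (0 : E) 1).eventually_forall_of_forall_eventually fun v hv => ?_
    have hv1 : ‖v‖ = 1 := by simpa using hv
    have hc : ContinuousAt (fun q : E × E => hess σ q.1 q.2 q.2) (p, v) := by
      have h1 : ContinuousAt (fun q : E × E => hess σ q.1) (p, v) :=
        ContinuousAt.comp (f := Prod.fst) hσ.continuousAt_hess continuousAt_fst
      exact (h1.clm_apply continuousAt_snd).clm_apply continuousAt_snd
    refine continuousAt_const.eventually_lt hc ?_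
    have := hK v (by intro h0; simp [h0] at hv1)
    rwa [hv1, one_pow, mul_one] at this
  obtain ⟨δ, hδ, hball⟩ := Metric.eventually_nhds_iff_ball.1
    (hsphere.and (hσ.eventually (by simp)))
  have hhess : ∀ x ∈ Metric.ball p δ, ∀ v, 0 ≤ hess σ x v v - K * ‖v‖ ^ 2 := by
    intro x hx v
    by_cases hv : v = 0
    · simp [hv]
    have hvn : 0 < ‖v‖ := norm_pos_iff.2 hv
    have := (hball x hx).1 (‖v‖⁻¹ • v) (by
      rw [mem_sphere_zero_iff_norm, norm_smul, norm_inv, norm_norm, inv_mul_cancel₀ hvn.ne'])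
    simp only [map_smul, smul_apply, smul_eq_mul] at this
    rw [← mul_assoc, ← sq, inv_pow, inv_mul_eq_div, lt_div_iff₀ (by positivity)] at this
    linarith
  filter_upwards [prod_mem_nhds (Metric.ball_mem_nhds p hδ) (Metric.ball_mem_nhds p hδ)]
    with q hq
  obtain ⟨x, y⟩ := q
  obtain ⟨hx, hy⟩ : x ∈ Metric.ball p δ ∧ y ∈ Metric.ball p δ := hq
  simp only
  set d := y - x with hd
  have hγ : ∀ t ∈ Icc (0 : ℝ) 1, x + t • d ∈ Metric.ball p δ := fun t ht => by
    have := (convex_ball p δ) hx hy (sub_nonneg.2 ht.2) ht.1 (by ring)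
    convert! this using 1
    rw [hd]; module
  have hγ' : ∀ t : ℝ, HasDerivAt (fun t : ℝ => x + t • d) d t := fun t => by
    simpa using ((hasDerivAt_id t).smul_const d).const_add x
  have h1 : ∀ t ∈ Icc (0 : ℝ) 1, HasDerivAt (fun t => σ (x + t • d) - K / 2 * ‖d‖ ^ 2 * t ^ 2)
      (fderiv ℝ σ (x + t • d) d - K * ‖d‖ ^ 2 * t) t := fun t ht => by
    have a1 := ((hball _ (hγ t ht)).2.differentiableAt
      (by simp)).hasFDerivAt.comp_hasDerivAt t (hγ' t)
    have a2 := (hasDerivAt_pow 2 t).const_mul (K / 2 * ‖d‖ ^ 2)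
    have a3 : HasDerivAt (fun t => σ (x + t • d) - K / 2 * ‖d‖ ^ 2 * t ^ 2)
        (fderiv ℝ σ (x + t • d) d - K / 2 * ‖d‖ ^ 2 * ((2 : ℕ) * t ^ (2 - 1))) t := a1.sub a2
    refine a3.congr_deriv ?_
    norm_num
    ring
  have h2 : ∀ t ∈ Icc (0 : ℝ) 1, HasDerivAt (fun t => fderiv ℝ σ (x + t • d) d - K * ‖d‖ ^ 2 * t)
      (hess σ (x + t • d) d d - K * ‖d‖ ^ 2) t := fun t ht => by
    have a0 : HasDerivAt (fun t => fderiv ℝ σ (x + t • d)) (hess σ (x + t • d) d) t :=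
      HasFDerivAt.comp_hasDerivAt t (hball _ (hγ t ht)).2.hasFDerivAt_fderiv (hγ' t)
    have a1 : HasDerivAt (fun t => fderiv ℝ σ (x + t • d) d) (hess σ (x + t • d) d d) t := by
      have := a0.clm_apply (hasDerivAt_const t d)
      rwa [map_zero, add_zero] at this
    have a2 : HasDerivAt (fun t : ℝ => K * ‖d‖ ^ 2 * t) (K * ‖d‖ ^ 2) t := by
      simpa using (hasDerivAt_id t).const_mul (K * ‖d‖ ^ 2)
    exact a1.sub a2
  have hconv := convexOn_of_hasDerivWithinAt2_nonneg (convex_Icc (0 : ℝ) 1)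
    (fun t ht => (h1 t ht).continuousAt.continuousWithinAt)
    (fun t ht => (h1 t (interior_subset ht)).hasDerivWithinAt)
    (fun t ht => (h2 t (interior_subset ht)).hasDerivWithinAt)
    (fun t ht => hhess _ (hγ t (interior_subset ht)) d)
  have := hconv.2 (left_mem_Icc.2 zero_le_one) (right_mem_Icc.2 zero_le_one)
    (by norm_num : (0 : ℝ) ≤ 1 / 2) (by norm_num : (0 : ℝ) ≤ 1 / 2) (by norm_num)
  have e1 : x + (1 / 2 : ℝ) • d = (1 / 2 : ℝ) • (x + y) := by rw [hd]; module
  have e2 : x + d = y := by rw [hd]; abel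
  simp only [smul_eq_mul, mul_zero, mul_one, zero_add, zero_smul, add_zero, one_smul, e1, e2]
    at this
  rw [norm_sub_rev x y, ← hd]
  linarith

/-- Near a boundary point `p` at which the nonnegative function `u` vanishes and its gradient has
the nonzero limit `G`, the function `u` dominates `|G| |σ| / |∇σ(p)|` up to a factor close to `1`,
for every `σ` vanishing on the boundary: follow `-G` from the given point until leaving `Ω`. -/
lemma eventually_mul_abs_le {E : Type*} [NormedAddCommGroup E] [InnerProductSpace ℝ E]
    [CompleteSpace E] {Ω : Set E} (hΩ : IsOpen Ω) {u σ : E → ℝ} {p G : E} {A B : ℝ}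
    (hp : p ∈ closure Ω) (huc : ContinuousOn u (closure Ω))
    (hud : ∀ x ∈ Ω, DifferentiableAt ℝ u x) (hu0 : ∀ x ∈ closure Ω, 0 ≤ u x) (hup : u p = 0)
    (hG : Tendsto (gradient u) (𝓝[Ω] p) (𝓝 G))
    (hσ : ContDiffAt ℝ 2 σ p) (hσ0 : ∀ᶠ q in 𝓝 p, q ∈ frontier Ω → σ q = 0)
    (hA0 : 0 < A) (hA : A < ‖G‖) (hB : ‖fderiv ℝ σ p‖ < B) :
    ∀ᶠ z in 𝓝 p, z ∈ closure Ω → A * |σ z| ≤ B * u z := by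
  have hB0 : 0 < B := (norm_nonneg _).trans_lt hB
  have hGn : 0 < ‖G‖ := hA0.trans hA
  set w := -(‖G‖⁻¹ • G) with hw
  have hwn : ‖w‖ = 1 := by
    rw [hw, norm_neg, norm_smul, norm_inv, norm_norm, inv_mul_cancel₀ hGn.ne']
  have hGw : inner ℝ G w = -‖G‖ := by
    rw [hw, inner_neg_right, inner_smul_right, real_inner_self_eq_norm_sq]; field_simp
  have hgrad : ∀ᶠ z in 𝓝 p, z ∈ Ω → inner ℝ (gradient u z) w < -A := by
    rw [← eventually_nhdsWithin_iff]
    exact (hG.inner tendsto_const_nhds).eventually_lt_const (by rw [hGw]; linarith)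
  have hσB : ∀ᶠ z in 𝓝 p, ‖fderiv ℝ σ z‖ < B :=
    (hσ.hasFDerivAt_fderiv.continuousAt.norm).eventually_lt continuousAt_const hB
  obtain ⟨δ, hδ, hball⟩ := Metric.eventually_nhds_iff_ball.1
    (hgrad.and (hσB.and (hσ.eventually_differentiableAt_two.and hσ0)))
  have husmall : ∀ᶠ z in 𝓝 p, z ∈ closure Ω → u z < A * (δ / 2) := by
    rw [← eventually_nhdsWithin_iff]
    exact (huc p hp).eventually_lt_const (by rw [hup]; positivity)
  filter_upwards [husmall, Metric.ball_mem_nhds p (half_pos hδ)] with z hzu hzp hz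
  have hzball : z ∈ Metric.ball p δ := Metric.ball_subset_ball (by linarith) hzp
  by_cases hzΩ : z ∈ Ω
  swap
  · have hzf : z ∈ frontier Ω := ⟨hz, fun hi => hzΩ (interior_subset hi)⟩
    rw [(hball z hzball).2.2.2 hzf, abs_zero, mul_zero]
    exact mul_nonneg hB0.le (hu0 z hz)
  have hpath : ∀ t ∈ Icc (0 : ℝ) (δ / 2), z + t • w ∈ Metric.ball p δ := by
    intro t ht
    rw [Metric.mem_ball, dist_eq_norm] at hzp ⊢
    calc ‖z + t • w - p‖ = ‖(z - p) + t • w‖ := by congr 1; abel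
      _ ≤ ‖z - p‖ + ‖t • w‖ := norm_add_le _ _
      _ ≤ ‖z - p‖ + t := by rw [norm_smul, hwn, mul_one, Real.norm_of_nonneg ht.1]
      _ < δ := by linarith [ht.2]
  have hγc : Continuous fun t : ℝ => z + t • w := by fun_prop
  -- `u` decreases at rate at least `A` along the path as long as it stays in `Ω`
  have hdec : ∀ T ∈ Ioc (0 : ℝ) (δ / 2), (∀ t ∈ Ico (0 : ℝ) T, z + t • w ∈ Ω) →
      z + T • w ∈ closure Ω ∧ u (z + T • w) ≤ u z - A * T := by
    intro T hT hin
    have hcl : ∀ t ∈ Icc (0 : ℝ) T, z + t • w ∈ closure Ω := by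
      intro t ht
      rw [← closure_Ico hT.1.ne] at ht
      exact map_mem_closure (f := fun t : ℝ => z + t • w) hγc ht hin
    refine ⟨hcl T ⟨hT.1.le, le_rfl⟩, ?_⟩
    have hderiv : ∀ t ∈ Ioo (0 : ℝ) T, HasDerivAt (fun t : ℝ => u (z + t • w))
        (inner ℝ (gradient u (z + t • w)) w) t := fun t ht => by
      have h1 : HasDerivAt (fun t : ℝ => z + t • w) w t := by
        simpa using ((hasDerivAt_id t).smul_const w).const_add z
      rw [inner_gradient_left]
      exact (hud _ (hin t ⟨ht.1.le, ht.2⟩)).hasFDerivAt.comp_hasDerivAt t h1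
    have := (convex_Icc (0 : ℝ) T).image_sub_le_mul_sub_of_deriv_le
      (f := fun t : ℝ => u (z + t • w)) (C := -A)
      (huc.comp hγc.continuousOn hcl)
      (by
        rw [interior_Icc]
        exact fun t ht => (hderiv t ht).differentiableAt.differentiableWithinAt)
      (by
        rw [interior_Icc]
        intro t ht
        rw [(hderiv t ht).deriv]
        exact ((hball _ (hpath t ⟨ht.1.le, ht.2.le.trans hT.2⟩)).1 (hin t ⟨ht.1.le, ht.2⟩)).le)
      0 ⟨le_rfl, hT.1.le⟩ T ⟨hT.1.le, le_rfl⟩ hT.1.le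
    simp only [zero_smul, add_zero, sub_zero] at this
    linarith
  set S : Set ℝ := Icc (0 : ℝ) (δ / 2) ∩ {t | z + t • w ∉ Ω} with hS
  have hSc : IsCompact S := isCompact_Icc.inter_right (hΩ.isClosed_compl.preimage hγc)
  have hSne : S.Nonempty := by
    by_contra hemp
    rw [not_nonempty_iff_eq_empty] at hemp
    have hin : ∀ t ∈ Icc (0 : ℝ) (δ / 2), z + t • w ∈ Ω := fun t ht => by
      by_contra hn
      have : t ∈ S := ⟨ht, hn⟩
      rw [hemp] at this
      exact this
    obtain ⟨h1, h2⟩ := hdec (δ / 2) ⟨half_pos hδ, le_rfl⟩ fun t ht => hin t ⟨ht.1, ht.2.le⟩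
    have := hu0 _ h1
    have := hzu hz
    linarith
  obtain ⟨τ, ⟨hτ, hτn⟩, hτmin⟩ := hSc.exists_isLeast hSne
  have hτ0 : 0 < τ := by
    refine lt_of_le_of_ne hτ.1 fun h0 => hτn ?_
    rw [← h0]; simpa using hzΩ
  obtain ⟨hqc, hqu⟩ := hdec τ ⟨hτ0, hτ.2⟩ fun t ht => by
    by_contra hn
    exact absurd (hτmin ⟨⟨ht.1, ht.2.le.trans hτ.2⟩, hn⟩) (not_le.2 ht.2)
  have hq0 : σ (z + τ • w) = 0 :=
    (hball _ (hpath τ hτ)).2.2.2 ⟨hqc, fun hi => hτn (interior_subset hi)⟩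
  have hLip := (convex_ball p δ).norm_image_sub_le_of_norm_fderiv_le (𝕜 := ℝ) (f := σ) (C := B)
    (fun x hx => (hball x hx).2.2.1) (fun x hx => (hball x hx).2.1.le) hzball (hpath τ hτ)
  rw [hq0, zero_sub, norm_neg, Real.norm_eq_abs, add_sub_cancel_left, norm_smul, hwn, mul_one,
    Real.norm_of_nonneg hτ.1] at hLip
  have := hu0 _ hqc
  calc A * |σ z| ≤ A * (B * τ) := mul_le_mul_of_nonneg_left hLip hA0.le
    _ = B * (A * τ) := by ring
    _ ≤ B * u z := mul_le_mul_of_nonneg_left (by linarith) hB0.le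

/-- From local alternatives to a uniform one on a compact set. -/
lemma IsCompact.exists_pos_forall_le_or_le {X : Type*} [TopologicalSpace X] {K : Set X}
    (hK : IsCompact K) {g F : X → ℝ}
    (h : ∀ x ∈ K, ∃ m > 0, ∀ᶠ y in 𝓝[K] x, g y ≤ F y ∨ m ≤ F y) :
    ∃ m > 0, ∀ x ∈ K, g x ≤ F x ∨ m ≤ F x := by
  refine hK.induction_on (p := fun s => ∃ m > 0, ∀ x ∈ s, g x ≤ F x ∨ m ≤ F x)
    ⟨1, one_pos, by simp⟩ (fun s t hst ⟨m, hm, ht⟩ => ⟨m, hm, fun x hx => ht x (hst hx)⟩) ?_ ?_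
  · rintro s t ⟨m, hm, hs⟩ ⟨m', hm', ht⟩
    refine ⟨min m m', lt_min hm hm', fun x hx => ?_⟩
    rcases hx with hx | hx
    · exact (hs x hx).imp id fun h => (min_le_left _ _).trans h
    · exact (ht x hx).imp id fun h => (min_le_right _ _).trans h
  · intro x hx
    obtain ⟨m, hm, he⟩ := h x hx
    exact ⟨_, he, m, hm, fun y hy => hy⟩

/-- Finsler's lemma: a quadratic form that exceeds `K |v|²` on the kernel of a linear form does so
everywhere after adding a large multiple of the square of that linear form. -/
lemma exists_forall_lt_add_mul_sq {E : Type*} [NormedAddCommGroup E] [InnerProductSpace ℝ E]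
    [FiniteDimensional ℝ E] {H : E →L[ℝ] E →L[ℝ] ℝ} {L : E →L[ℝ] ℝ} {K : ℝ}
    (h : ∀ v, L v = 0 → v ≠ 0 → K * ‖v‖ ^ 2 < H v v) :
    ∃ M : ℝ, ∀ v, v ≠ 0 → K * ‖v‖ ^ 2 < H v v + M * L v ^ 2 := by
  obtain ⟨N, hN⟩ := (isCompact_sphere (0 : E) 1).elim_directed_cover
    (fun N : ℕ => {v : E | K < H v v + N * L v ^ 2})
    (fun N => isOpen_lt continuous_const (by fun_prop)) (fun v hv => by
      have hv1 : ‖v‖ = 1 := by simpa using hv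
      have hv0 : v ≠ 0 := by intro h0; simp [h0] at hv1
      rw [mem_iUnion]
      by_cases hL : L v = 0
      · refine ⟨0, ?_⟩
        have := h v hL hv0
        simpa [hv1] using this
      · have hL2 : 0 < L v ^ 2 := by positivity
        obtain ⟨N, hN⟩ := exists_nat_gt ((K - H v v) / L v ^ 2)
        refine ⟨N, ?_⟩
        rw [div_lt_iff₀ hL2] at hN
        change K < H v v + N * L v ^ 2
        linarith)
    (directed_of_isDirected_le fun a b hab v hv => by
      have hv : K < H v v + a * L v ^ 2 := hv
      have : (a : ℝ) * L v ^ 2 ≤ b * L v ^ 2 :=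
        mul_le_mul_of_nonneg_right (by exact_mod_cast hab) (sq_nonneg _)
      change K < H v v + b * L v ^ 2
      linarith)
  refine ⟨N, fun v hv => ?_⟩
  have hvn : 0 < ‖v‖ := norm_pos_iff.2 hv
  have := hN (show ‖v‖⁻¹ • v ∈ Metric.sphere (0 : E) 1 by
    rw [mem_sphere_zero_iff_norm, norm_smul, norm_inv, norm_norm, inv_mul_cancel₀ hvn.ne'])
  simp only [mem_ofPred_eq, map_smul, smul_apply, smul_eq_mul] at this
  have h2 : 0 < ‖v‖ ^ 2 := by positivity
  calc K * ‖v‖ ^ 2 < (‖v‖⁻¹ * (‖v‖⁻¹ * H v v) + N * (‖v‖⁻¹ * L v) ^ 2) * ‖v‖ ^ 2 :=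
        mul_lt_mul_of_pos_right this h2
    _ = H v v + N * L v ^ 2 := by field_simp

namespace IsC2DefiningFunction

variable {n : ℕ} {D : Set (EuclideanSpace ℝ (Fin n))} {p : EuclideanSpace ℝ (Fin n)}
  {ρ : EuclideanSpace ℝ (Fin n) → ℝ}

/-- Below the smallest principal curvature, the curvature bound can be realized by the Hessian of a
defining function in all directions, by passing from `ρ` to `ρ + M ρ²`. -/
lemma exists_strongly_convex (hn : 2 ≤ n) (h : IsC2DefiningFunction ρ D p) {k : ℝ}
    (hk : k < smallestPrincipalCurvature D p) :
    ∃ σ, IsC2DefiningFunction σ D p ∧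
      ∀ v, v ≠ 0 → k * ‖gradient σ p‖ * ‖v‖ ^ 2 < hess σ p v v := by
  have hg : 0 < ‖gradient ρ p‖ := norm_pos_iff.2 h.gradient_ne_zero
  obtain ⟨M, hM⟩ := exists_forall_lt_add_mul_sq (H := hess ρ p) (L := fderiv ℝ ρ p)
    (K := k * ‖gradient ρ p‖) (fun v hv hv0 => by
      have h1 := (h.smallestPrincipalCurvature_spec hn).2 v (by simpa using hv)
      have hvn : 0 < ‖v‖ := norm_pos_iff.2 hv0
      refine lt_of_lt_of_le ?_ h1
      gcongr)
  set σ : EuclideanSpace ℝ (Fin n) → ℝ := fun x => ρ x + M / 2 * ρ x ^ 2 with hσ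
  have hfd : fderiv ℝ σ =ᶠ[𝓝 p] fun x => (1 + M * ρ x) • fderiv ℝ ρ x := by
    filter_upwards [h.contDiffAt.eventually_differentiableAt_two] with x hx
    have h1 := hx.hasFDerivAt.add ((hx.hasFDerivAt.pow 2).const_mul (M / 2))
    rw [show fderiv ℝ σ x = _ from h1.fderiv]
    ext v
    simp
    ring
  have hgrad : gradient σ p = gradient ρ p := by
    refine ext_inner_right ℝ fun v => ?_
    rw [inner_gradient_left, inner_gradient_left,
      show fderiv ℝ σ p = (1 + M * ρ p) • fderiv ℝ ρ p from hfd.self_of_nhds, h.eq_zero]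
    simp
  have hhess : ∀ v, hess σ p v v = hess ρ p v v + M * fderiv ℝ ρ p v ^ 2 := by
    intro v
    have hd := h.contDiffAt.differentiableAt (by simp)
    have h1 := ((hd.hasFDerivAt.const_mul M).const_add 1).smul h.contDiffAt.hasFDerivAt_fderiv
    rw [hess, hfd.fderiv_eq]
    rw [show fderiv ℝ (fun x => (1 + M * ρ x) • fderiv ℝ ρ x) p = _ from h1.fderiv, h.eq_zero]
    simp
    ring
  refine ⟨σ, ⟨h.contDiffAt.add (contDiffAt_const.mul (h.contDiffAt.pow 2)), ?_, ?_, ?_⟩, ?_⟩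
  · simp [hσ, h.eq_zero]
  · rw [hgrad]; exact h.gradient_ne_zero
  · have hpos : ∀ᶠ x in 𝓝 p, 0 < 1 + M / 2 * ρ x := by
      have hc : ContinuousAt (fun x => 1 + M / 2 * ρ x) p :=
        continuousAt_const.add (continuousAt_const.mul h.contDiffAt.continuousAt)
      exact continuousAt_const.eventually_lt hc (by simp [h.eq_zero])
    filter_upwards [h.mem_iff, hpos] with x hx hx'
    rw [hx, show σ x = (1 + M / 2 * ρ x) * ρ x by simp only [hσ]; ring]
    constructor
    · intro h0; exact mul_neg_of_pos_of_neg hx' h0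
    · intro h0; by_contra hn; push Not at hn
      have := mul_nonneg hx'.le hn
      linarith
  · intro v hv
    rw [hgrad, hhess]
    exact hM v hv

/-- Near `p` the defining function vanishes on the frontier and is nonpositive on the closure. -/
lemma eventually_frontier (h : IsC2DefiningFunction ρ D p) (hD : IsOpen D) :
    ∀ᶠ q in 𝓝 p, (q ∈ closure D → ρ q ≤ 0) ∧ (q ∈ frontier D → ρ q = 0) := by
  filter_upwards [h.mem_iff.eventually_nhds, h.contDiffAt.eventually (by simp)] with q hq hc
  have hle : q ∈ closure D → ρ q ≤ 0 := by
    intro hqD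
    by_contra hpos
    push Not at hpos
    have h1 : ∀ᶠ y in 𝓝 q, 0 < ρ y := continuousAt_const.eventually_lt hc.continuousAt hpos
    obtain ⟨y, hy, hy1, hy2⟩ := ((mem_closure_iff_frequently.1 hqD).and_eventually
      (h1.and hq)).exists
    have := hy2.1 hy
    linarith
  refine ⟨hle, fun hqf => le_antisymm (hle hqf.1) ?_⟩
  by_contra hneg
  push Not at hneg
  have := hq.self_of_nhds.2 hneg
  exact hqf.2 (by rwa [hD.interior_eq])

/-- A region with `C²` boundary does not fill a neighbourhood of a boundary point. -/
lemma notMem_interior_closure (h : IsC2DefiningFunction ρ D p) (hD : IsOpen D) :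
    p ∉ interior (closure D) := by
  intro hp
  refine h.gradient_ne_zero ?_
  have hmax : IsLocalMax ρ p := by
    filter_upwards [h.eventually_frontier hD, isOpen_interior.mem_nhds hp] with q hq hq'
    rw [h.eq_zero]
    exact hq.1 (interior_subset hq')
  refine ext_inner_right ℝ fun v => ?_
  rw [inner_gradient_left, hmax.fderiv_eq_zero]
  simp

end IsC2DefiningFunction

lemma HasC2Boundary.interior_closure {n : ℕ} {D : Set (EuclideanSpace ℝ (Fin n))}
    (h : HasC2Boundary D) (hD : IsOpen D) : interior (closure D) = D := by
  refine subset_antisymm (fun x hx => ?_) (hD.subset_interior_iff.2 subset_closure)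
  by_contra hxD
  obtain ⟨ρ, hρ⟩ := h x ⟨interior_subset hx, by rwa [hD.interior_eq]⟩
  exact hρ.notMem_interior_closure hD hx

end

/-! ### Curvature bounds from the boundary to the interior -/

section

variable {n : ℕ} {Ω₀ Ω₁ D : Set (EuclideanSpace ℝ (Fin n))} {U : EuclideanSpace ℝ (Fin n) → ℝ}
  {p : EuclideanSpace ℝ (Fin n)}

lemma norm_fderiv_eq_norm_gradient {E : Type*} [NormedAddCommGroup E] [InnerProductSpace ℝ E]
    [CompleteSpace E] (f : E → ℝ) (x : E) : ‖fderiv ℝ f x‖ = ‖gradient f x‖ := by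
  simp [gradient]

/-- Constants for comparing a potential with gradient `G` at `p` with a strongly convex defining
function. -/
lemma IsC2DefiningFunction.exists_barrier {ρ : EuclideanSpace ℝ (Fin n) → ℝ} (hn : 2 ≤ n)
    (h : IsC2DefiningFunction ρ D p) {g c : ℝ} (hg : 0 < g) (hc : 0 < c)
    (hcg : c < g * smallestPrincipalCurvature D p) :
    ∃ (σ : EuclideanSpace ℝ (Fin n) → ℝ) (A B K : ℝ), IsC2DefiningFunction σ D p ∧ 0 < A ∧ A < g ∧
      ‖fderiv ℝ σ p‖ < B ∧ A * K = c * B ∧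
      ∀ᶠ q : EuclideanSpace ℝ (Fin n) × EuclideanSpace ℝ (Fin n) in 𝓝 (p, p),
        σ ((1 / 2 : ℝ) • (q.1 + q.2)) ≤ 1 / 2 * (σ q.1 + σ q.2) - K / 8 * ‖q.1 - q.2‖ ^ 2 := by
  obtain ⟨k, hk1, hk2⟩ := exists_between ((div_lt_iff₀' hg).2 hcg)
  have hk0 : 0 < k := (div_pos hc hg).trans hk1
  rw [div_lt_iff₀ hg] at hk1
  obtain ⟨A, hA1, hA2⟩ := exists_between ((div_lt_iff₀' hk0).2 hk1)
  obtain ⟨σ, hσ, hconv⟩ := h.exists_strongly_convex hn hk2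
  have hN : 0 < ‖gradient σ p‖ := norm_pos_iff.2 hσ.gradient_ne_zero
  refine ⟨σ, A, A * k * ‖gradient σ p‖ / c, k * ‖gradient σ p‖, hσ, (div_pos hc hk0).trans hA1,
    hA2, ?_, by field_simp, eventually_midpoint_le hσ.contDiffAt hconv⟩
  rw [norm_fderiv_eq_norm_gradient, lt_div_iff₀ hc]
  rw [div_lt_iff₀ hk0] at hA1
  nlinarith

namespace IsRingPotential

lemma mem_closure_ring (h : IsRingPotential Ω₀ Ω₁ U) {x : EuclideanSpace ℝ (Fin n)}
    (hx : x ∈ closure Ω₀) (hx1 : x ∉ Ω₁) : x ∈ closure (Ω₀ \ closure Ω₁) := by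
  by_cases hc : x ∈ closure Ω₁
  · have hi : x ∉ interior (closure Ω₁) := by rwa [h.interior_closure_inner]
    rw [mem_interior_iff_mem_nhds] at hi
    have hf : ∃ᶠ y in 𝓝 x, y ∉ closure Ω₁ := fun he => hi (he.mono fun y hy => not_not.1 hy)
    rw [mem_closure_iff_frequently]
    exact (hf.and_eventually (h.isOpen_outer.mem_nhds (h.closure_inner_subset hc))).mono
      fun y hy => ⟨hy.2, hy.1⟩
  · rw [mem_closure_iff_frequently] at hx ⊢
    exact (hx.and_eventually (isClosed_closure.isOpen_compl.mem_nhds hc)).mono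
      fun y hy => ⟨hy.1, hy.2⟩

lemma closure_ring_subset (h : IsRingPotential Ω₀ Ω₁ U) :
    closure (Ω₀ \ closure Ω₁) ⊆ closure Ω₀ \ Ω₁ := fun x hx => by
  refine ⟨closure_mono sdiff_subset hx, fun hx1 => ?_⟩
  obtain ⟨y, hy, hy1⟩ := ((mem_closure_iff_frequently.1 hx).and_eventually
    (h.isOpen_inner.mem_nhds hx1)).exists
  exact hy.2 (subset_closure hy1)

lemma frontier_outer_subset (h : IsRingPotential Ω₀ Ω₁ U) (hp : p ∈ frontier Ω₀) :
    p ∈ closure (Ω₀ \ closure Ω₁) ∧ p ∉ Ω₀ := by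
  have hp0 : p ∉ Ω₀ := fun h0 => hp.2 (by rwa [h.isOpen_outer.interior_eq])
  exact ⟨h.mem_closure_ring hp.1 fun h1 => hp0 (h.closure_inner_subset (subset_closure h1)), hp0⟩

lemma frontier_inner_subset (h : IsRingPotential Ω₀ Ω₁ U) (hp : p ∈ frontier Ω₁) :
    p ∈ closure (Ω₀ \ closure Ω₁) :=
  h.mem_closure_ring (subset_closure (h.closure_inner_subset hp.1))
    fun h1 => hp.2 (by rwa [h.isOpen_inner.interior_eq])

lemma mem_cases (h : IsRingPotential Ω₀ Ω₁ U) (hp : p ∈ closure (Ω₀ \ closure Ω₁)) :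
    p ∈ Ω₀ \ closure Ω₁ ∨ p ∈ frontier Ω₀ ∨ p ∈ frontier Ω₁ := by
  have h1 := h.closure_ring_subset hp
  by_cases hc : p ∈ closure Ω₁
  · exact .inr (.inr ⟨hc, fun hi => h1.2 (interior_subset hi)⟩)
  by_cases h0 : p ∈ Ω₀
  · exact .inl ⟨h0, hc⟩
  · exact .inr (.inl ⟨h1.1, fun hi => h0 (interior_subset hi)⟩)

lemma frontier_ring (h : IsRingPotential Ω₀ Ω₁ U) :
    frontier (Ω₀ \ closure Ω₁) = frontier Ω₀ ∪ frontier Ω₁ := by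
  rw [frontier, h.isOpen_ring.interior_eq]
  ext x
  constructor
  · rintro ⟨hx, hx'⟩
    exact (h.mem_cases hx).resolve_left hx'
  · rintro (hx | hx)
    · exact ⟨(h.frontier_outer_subset hx).1, fun hr => (h.frontier_outer_subset hx).2 hr.1⟩
    · exact ⟨h.frontier_inner_subset hx, fun hr => hr.2 hx.1⟩

/-- The penalized inequality near the diagonal of the outer boundary. -/
lemma eventually_outer (h : IsRingPotential Ω₀ Ω₁ U) (hn : 2 ≤ n)
    {ρ : EuclideanSpace ℝ (Fin n) → ℝ} (hρ : IsC2DefiningFunction ρ Ω₀ p) (hp : p ∈ frontier Ω₀)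
    {G : EuclideanSpace ℝ (Fin n)} (hG0 : G ≠ 0)
    (hG : Tendsto (gradient U) (𝓝[Ω₀ \ closure Ω₁] p) (𝓝 G)) {c : ℝ} (hc : 0 < c)
    (hcG : c < ‖G‖ * smallestPrincipalCurvature Ω₀ p) :
    ∀ᶠ q : EuclideanSpace ℝ (Fin n) × EuclideanSpace ℝ (Fin n) in 𝓝 (p, p),
      q.1 ∈ frontier Ω₀ → q.2 ∈ closure Ω₀ →
        c / 8 * ‖q.1 - q.2‖ ^ 2 ≤ U ((1 / 2 : ℝ) • (q.1 + q.2)) := by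
  obtain ⟨σ, A, B, K, hσ, hA0, hA, hB, hAB, hmid⟩ :=
    hρ.exists_barrier hn (norm_pos_iff.2 hG0) hc hcG
  have hB0 : 0 < B := (norm_nonneg _).trans_lt hB
  have hpc : p ∉ closure Ω₁ := fun h1 =>
    (h.frontier_outer_subset hp).2 (h.closure_inner_subset h1)
  have hσe := hσ.eventually_frontier h.isOpen_outer
  have hbar := eventually_mul_abs_le h.isOpen_ring (h.frontier_outer_subset hp).1
    (h.continuousOn.mono fun x hx => (h.closure_ring_subset hx).1)
    (fun x hx => (h.harmonicAt x hx).1.differentiableAt (by simp))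
    (fun x hx => h.nonneg (h.closure_ring_subset hx).1) (h.eq_zero p hp) hG hσ.contDiffAt
    (by
      filter_upwards [hσe, isClosed_closure.isOpen_compl.mem_nhds hpc] with q hq hqc hqf
      rw [h.frontier_ring] at hqf
      exact hq.2 (hqf.resolve_right fun h1 => hqc h1.1)) hA0 hA hB
  have hzlim : Tendsto (fun q : EuclideanSpace ℝ (Fin n) × EuclideanSpace ℝ (Fin n) =>
      (1 / 2 : ℝ) • (q.1 + q.2)) (𝓝 (p, p)) (𝓝 p) := by
    have hc : Continuous fun q : EuclideanSpace ℝ (Fin n) × EuclideanSpace ℝ (Fin n) =>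
      (1 / 2 : ℝ) • (q.1 + q.2) := by fun_prop
    have := hc.tendsto (p, p)
    rwa [show (1 / 2 : ℝ) • (p + p) = p by module] at this
  filter_upwards [hmid, hzlim.eventually (hbar.and (isClosed_closure.isOpen_compl.mem_nhds hpc)),
    continuousAt_fst.eventually hσe, continuousAt_snd.eventually hσe] with q h1 h2 h3 h4 hq1 hq2
  have hz := h.mem_closure_ring (h.strictConvex_outer.convex.half_smul_add_mem hq1.1 hq2)
    fun hi => h2.2 (subset_closure hi)
  have h5 := h2.1 hz
  have h6 := h3.2 hq1
  have h7 := h4.1 hq2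
  have h8 := neg_abs_le (σ ((1 / 2 : ℝ) • (q.1 + q.2)))
  have h9 : K / 8 * ‖q.1 - q.2‖ ^ 2 ≤ |σ ((1 / 2 : ℝ) • (q.1 + q.2))| := by linarith
  have h10 := mul_le_mul_of_nonneg_left h9 hA0.le
  refine le_of_mul_le_mul_left ?_ hB0
  calc B * (c / 8 * ‖q.1 - q.2‖ ^ 2) = A * (K / 8 * ‖q.1 - q.2‖ ^ 2) := by
        linear_combination (-‖q.1 - q.2‖ ^ 2 / 8) * hAB
    _ ≤ _ := h10.trans h5

/-- The penalized inequality near the diagonal of the inner boundary. -/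
lemma eventually_inner (h : IsRingPotential Ω₀ Ω₁ U) (hn : 2 ≤ n)
    {ρ : EuclideanSpace ℝ (Fin n) → ℝ} (hρ : IsC2DefiningFunction ρ Ω₁ p) (hp : p ∈ frontier Ω₁)
    {G : EuclideanSpace ℝ (Fin n)} (hG0 : G ≠ 0)
    (hG : Tendsto (gradient U) (𝓝[Ω₀ \ closure Ω₁] p) (𝓝 G)) {c : ℝ} (hc : 0 < c)
    (hcG : c < ‖G‖ * smallestPrincipalCurvature Ω₁ p) :
    ∀ᶠ q : EuclideanSpace ℝ (Fin n) × EuclideanSpace ℝ (Fin n) in 𝓝 (p, p),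
      q.1 ∈ closure Ω₀ → q.2 ∈ closure Ω₀ → (1 / 2 : ℝ) • (q.1 + q.2) ∈ frontier Ω₁ →
        c / 8 * ‖q.1 - q.2‖ ^ 2 ≤ 1 - min (U q.1) (U q.2) := by
  obtain ⟨σ, A, B, K, hσ, hA0, hA, hB, hAB, hmid⟩ :=
    hρ.exists_barrier hn (norm_pos_iff.2 hG0) hc hcG
  have hB0 : 0 < B := (norm_nonneg _).trans_lt hB
  have hpΩ : p ∈ Ω₀ := h.closure_inner_subset hp.1
  have hσe := hσ.eventually_frontier h.isOpen_inner
  have hgr : gradient (fun x => 1 - U x) = fun x => -gradient U x := by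
    funext x
    refine ext_inner_right ℝ fun v => ?_
    rw [inner_neg_left, inner_gradient_left, inner_gradient_left, fderiv_const_sub]
    rfl
  have hbar := eventually_mul_abs_le (u := fun x => 1 - U x) (G := -G) h.isOpen_ring
    (h.frontier_inner_subset hp)
    (continuousOn_const.sub (h.continuousOn.mono fun x hx => (h.closure_ring_subset hx).1))
    (fun x hx => ((h.harmonicAt x hx).1.differentiableAt (by simp)).const_sub 1)
    (fun x hx => sub_nonneg.2 (h.le_one (h.closure_ring_subset hx).1))
    (by rw [h.eq_one p hp.1, sub_self]) (by rw [hgr]; exact hG.neg) hσ.contDiffAt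
    (by
      filter_upwards [hσe, h.isOpen_outer.mem_nhds hpΩ] with q hq hqc hqf
      rw [h.frontier_ring] at hqf
      exact hq.2 (hqf.resolve_left fun h1 => (h.frontier_outer_subset h1).2 hqc)) hA0
    (by rwa [norm_neg]) hB
  have hzlim : Tendsto (fun q : EuclideanSpace ℝ (Fin n) × EuclideanSpace ℝ (Fin n) =>
      (1 / 2 : ℝ) • (q.1 + q.2)) (𝓝 (p, p)) (𝓝 p) := by
    have hc : Continuous fun q : EuclideanSpace ℝ (Fin n) × EuclideanSpace ℝ (Fin n) =>
      (1 / 2 : ℝ) • (q.1 + q.2) := by fun_prop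
    have := hc.tendsto (p, p)
    rwa [show (1 / 2 : ℝ) • (p + p) = p by module] at this
  have hpt : ∀ᶠ x in 𝓝 p, x ∈ closure Ω₀ → A * σ x ≤ B * (1 - U x) := by
    filter_upwards [hbar, hσe] with x h1 h2 hx
    by_cases hxc : x ∈ closure Ω₁
    · rw [h.eq_one x hxc, sub_self, mul_zero]
      exact mul_nonpos_of_nonneg_of_nonpos hA0.le (h2.1 hxc)
    · have := h1 (h.mem_closure_ring hx fun hi => hxc (subset_closure hi))
      exact (mul_le_mul_of_nonneg_left (le_abs_self _) hA0.le).trans this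
  filter_upwards [hmid, hzlim.eventually hσe, continuousAt_fst.eventually hpt,
    continuousAt_snd.eventually hpt] with q h1 h2 h3 h4 hq1 hq2 hq
  have h5 := h3 hq1
  have h6 := h4 hq2
  rw [h2.2 hq] at h1
  have h7 := mul_le_mul_of_nonneg_left h1 hA0.le
  have h8 := mul_le_mul_of_nonneg_left (min_le_left (U q.1) (U q.2)) hB0.le
  have h9 := mul_le_mul_of_nonneg_left (min_le_right (U q.1) (U q.2)) hB0.le
  refine le_of_mul_le_mul_left ?_ hB0
  calc B * (c / 8 * ‖q.1 - q.2‖ ^ 2) = A * (K / 8 * ‖q.1 - q.2‖ ^ 2) := by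
        linear_combination (-‖q.1 - q.2‖ ^ 2 / 8) * hAB
    _ ≤ B * (1 - min (U q.1) (U q.2)) := by linarith

/-- If `|Du| κ₁ > c` on both boundary components, then `D²u(v, v) ≤ -c |v|²` for all vectors `v`
tangent to the level sets. -/
theorem hess_le (h : IsRingPotential Ω₀ Ω₁ U) (hn : 2 ≤ n) (h₀ : HasC2Boundary Ω₀)
    (h₁ : HasC2Boundary Ω₁) {G : EuclideanSpace ℝ (Fin n) → EuclideanSpace ℝ (Fin n)}
    (hGc : ContinuousOn G (closure (Ω₀ \ closure Ω₁)))
    (hGU : EqOn G (gradient U) (Ω₀ \ closure Ω₁)) {c : ℝ} (hc : 0 < c)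
    (hc₀ : ∀ q ∈ frontier Ω₀, c < ‖G q‖ * smallestPrincipalCurvature Ω₀ q)
    (hc₁ : ∀ q ∈ frontier Ω₁, c < ‖G q‖ * smallestPrincipalCurvature Ω₁ q)
    {z v : EuclideanSpace ℝ (Fin n)} (hz : z ∈ Ω₀ \ closure Ω₁)
    (hv : inner ℝ (gradient U z) v = 0) : hess U z v v ≤ -(c * ‖v‖ ^ 2) := by
  have hdim : 2 ≤ Module.finrank ℝ (EuclideanSpace ℝ (Fin n)) := by simpa using hn
  have hG0 : ∀ x ∈ closure (Ω₀ \ closure Ω₁), G x ≠ 0 := by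
    intro x hx h0
    rcases h.mem_cases hx with hx | hx | hx
    · exact h.gradient_ne_zero x hx (by rw [← hGU hx, h0])
    · have := hc₀ x hx
      rw [h0, norm_zero, zero_mul] at this; linarith
    · have := hc₁ x hx
      rw [h0, norm_zero, zero_mul] at this; linarith
  have hGt : ∀ x ∈ closure (Ω₀ \ closure Ω₁),
      Tendsto (gradient U) (𝓝[Ω₀ \ closure Ω₁] x) (𝓝 (G x)) := fun x hx =>
    ((hGc x hx).mono subset_closure).tendsto.congr'
      (eventually_nhdsWithin_of_forall fun y hy => hGU hy)
  have hring : IsCompact (closure (Ω₀ \ closure Ω₁)) :=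
    h.isCompact_closure.of_isClosed_subset isClosed_closure
      fun x hx => (h.closure_ring_subset hx).1
  obtain ⟨z₀, hz₀, hzmin⟩ := hring.exists_isMinOn ⟨z, subset_closure hz⟩ hGc.norm
  have hg : 0 < ‖G z₀‖ := norm_pos_iff.2 (hG0 z₀ hz₀)
  have hmidc : Continuous fun q : EuclideanSpace ℝ (Fin n) × EuclideanSpace ℝ (Fin n) =>
    (1 / 2 : ℝ) • (q.1 + q.2) := by fun_prop
  have hfc : ∀ S : Set (EuclideanSpace ℝ (Fin n)), frontier S ⊆ closure S :=
    fun S => frontier_subset_closure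
  -- the two boundary configurations: close to the diagonal the curvature bound applies, away from
  -- it strict convexity gives a positive gap
  obtain ⟨m₀, hm₀, hK₀⟩ := (IsCompact.prod
    (h.isCompact_closure.of_isClosed_subset isClosed_frontier (hfc Ω₀))
    h.isCompact_closure).exists_pos_forall_le_or_le
    (g := fun q => c / 8 * ‖q.1 - q.2‖ ^ 2) (F := fun q => U ((1 / 2 : ℝ) • (q.1 + q.2))) (by
      rintro ⟨x, y⟩ ⟨hx, hy⟩
      simp only at hx hy
      by_cases hxy : x = y
      · subst hxy
        obtain ⟨ρ, hρ⟩ := h₀ x hx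
        have hxr := (h.frontier_outer_subset hx).1
        refine ⟨1, one_pos, ?_⟩
        filter_upwards [nhdsWithin_le_nhds (h.eventually_outer hn hρ hx (hG0 x hxr) (hGt x hxr) hc
          (hc₀ x hx)), self_mem_nhdsWithin] with q hq hqK
        exact .inl (hq hqK.1 hqK.2)
      · have hzi := h.strictConvex_outer.half_smul_add_mem hx.1 hy hxy
        rw [h.interior_closure_outer] at hzi
        have hpos := h.pos_of_mem hzi
        refine ⟨_, half_pos hpos, ?_⟩
        have hcont : ContinuousAt (fun q : EuclideanSpace ℝ (Fin n) × EuclideanSpace ℝ (Fin n) =>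
            U ((1 / 2 : ℝ) • (q.1 + q.2))) (x, y) :=
          ContinuousAt.comp (f := fun q : EuclideanSpace ℝ (Fin n) × EuclideanSpace ℝ (Fin n) =>
            (1 / 2 : ℝ) • (q.1 + q.2)) (h.continuousAt hzi) hmidc.continuousAt
        filter_upwards [nhdsWithin_le_nhds (continuousAt_const.eventually_lt hcont
          (half_lt_self hpos))] with q hq
        exact .inr hq.le)
  obtain ⟨m₁, hm₁, hK₁⟩ := ((h.isCompact_closure.prod h.isCompact_closure).inter_right
    ((isClosed_frontier (s := Ω₁)).preimage hmidc)).exists_pos_forall_le_or_le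
    (g := fun q => c / 8 * ‖q.1 - q.2‖ ^ 2) (F := fun q => 1 - min (U q.1) (U q.2)) (by
      rintro ⟨x, y⟩ ⟨⟨hx, hy⟩, hxyz⟩
      simp only [mem_preimage] at hx hy hxyz
      by_cases hxy : x = y
      · subst hxy
        have hx1 : x ∈ frontier Ω₁ := by
          rwa [show (1 / 2 : ℝ) • (x + x) = x by module] at hxyz
        obtain ⟨ρ, hρ⟩ := h₁ x hx1
        have hxr := h.frontier_inner_subset hx1
        refine ⟨1, one_pos, ?_⟩
        filter_upwards [nhdsWithin_le_nhds (h.eventually_inner hn hρ hx1 (hG0 x hxr) (hGt x hxr) hc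
          (hc₁ x hx1)), self_mem_nhdsWithin] with q hq hqK
        exact .inl (hq hqK.1.1 hqK.1.2 hqK.2)
      · have hlt : ∀ w ∈ closure Ω₀, w ∉ closure Ω₁ → U w < 1 := fun w hw hw1 => by
          by_cases h0 : U w = 0
          · rw [h0]; exact zero_lt_one
          · exact h.lt_one w ⟨h.mem_outer_of_ne_zero hw h0, hw1⟩
        have hmin : min (U x) (U y) < 1 := by
          by_contra hge
          push Not at hge
          have hx1 : x ∈ closure Ω₁ := by
            by_contra hn; have := hlt x hx hn; have := min_le_left (U x) (U y); linarith
          have hy1 : y ∈ closure Ω₁ := by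
            by_contra hn; have := hlt y hy hn; have := min_le_right (U x) (U y); linarith
          have hzi := h.strictConvex_inner.half_smul_add_mem hx1 hy1 hxy
          rw [h.interior_closure_inner, ← h.isOpen_inner.interior_eq] at hzi
          exact hxyz.2 hzi
        refine ⟨(1 - min (U x) (U y)) / 2, by linarith, ?_⟩
        have hcont : ContinuousOn (fun q : EuclideanSpace ℝ (Fin n) × EuclideanSpace ℝ (Fin n) =>
            1 - min (U q.1) (U q.2)) (closure Ω₀ ×ˢ closure Ω₀) :=
          continuousOn_const.sub (ContinuousOn.inf
            (h.continuousOn.comp continuousOn_fst fun q hq => hq.1)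
            (h.continuousOn.comp continuousOn_snd fun q hq => hq.2))
        have hcont' := (hcont (x, y) ⟨hx, hy⟩).mono
          (inter_subset_left (t := (fun q : EuclideanSpace ℝ (Fin n) × EuclideanSpace ℝ (Fin n) =>
            (1 / 2 : ℝ) • (q.1 + q.2)) ⁻¹' frontier Ω₁))
        filter_upwards [hcont'.eventually_const_lt
          (show (1 - min (U x) (U y)) / 2 < 1 - min (U x) (U y) by linarith)] with q hq
        exact .inr hq.le)
  obtain ⟨R, hR⟩ := h.isCompact_closure.isBounded.exists_norm_le
  set m := min ‖G z₀‖ (min m₀ m₁) with hm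
  have hm0 : 0 < m := lt_min hg (lt_min hm₀ hm₁)
  have hmg : m ≤ ‖G z₀‖ := min_le_left _ _
  have hmm₀ : m ≤ m₀ := (min_le_right _ _).trans (min_le_left _ _)
  have hmm₁ : m ≤ m₁ := (min_le_right _ _).trans (min_le_right _ _)
  set r := m / (c * (|R| + 1)) with hr
  have hr0 : 0 < r := by positivity
  have hcr : c / 4 * r = m / (4 * (|R| + 1)) := by rw [hr]; field_simp
  have hk0 : 0 < c / 4 := by positivity
  have hpen : ∀ x ∈ closure Ω₀, ∀ y ∈ closure Ω₀, penalty (c / 4) r (x - y) ≤ m := by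
    intro x hx y hy
    have hxy : ‖x - y‖ ≤ 4 * (|R| + 1) := by
      have := norm_sub_le x y
      have := hR x hx
      have := hR y hy
      have := le_abs_self R
      have := abs_nonneg R
      linarith
    calc penalty (c / 4) r (x - y) ≤ c / 4 * r * ‖x - y‖ := penalty_le_norm hk0.le hr0 _
      _ ≤ m / (4 * (|R| + 1)) * (4 * (|R| + 1)) := by
        rw [hcr]; exact mul_le_mul_of_nonneg_left hxy (by positivity)
      _ = m := by field_simp
  have hpen2 : ∀ w : EuclideanSpace ℝ (Fin n), penalty (c / 4) r w ≤ c / 8 * ‖w‖ ^ 2 := fun w => by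
    have := penalty_le_sq hk0.le hr0 w
    linarith
  have hgrad : ∀ x ∈ Ω₀ \ closure Ω₁, 2 * (c / 4 * r) < ‖gradient U x‖ := by
    intro x hx
    have h1 : ‖G z₀‖ ≤ ‖gradient U x‖ := by
      rw [← hGU hx]; exact hzmin (subset_closure hx)
    have h2 : 2 * (c / 4 * r) < m := by
      rw [hcr, ← mul_div_assoc, div_lt_iff₀ (by positivity)]
      nlinarith [abs_nonneg R]
    linarith
  have key : ∀ x ∈ closure Ω₀, ∀ y ∈ closure Ω₀, (1 / 2 : ℝ) • (x + y) ∉ Ω₁ →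
      min (U x) (U y) + penalty (c / 4) r (x - y) ≤ U ((1 / 2 : ℝ) • (x + y)) := by
    intro x hx y hy hxy
    refine h.min_add_penalty_le_midpoint hdim hk0 hr0 hgrad (fun a ha b hb => ?_)
      (fun a ha b hb hab => ?_) hx hy hxy
    · rcases hK₀ (a, b) ⟨ha, hb⟩ with h1 | h1
      · exact (hpen2 _).trans h1
      · exact (hpen a ha.1 b hb).trans (hmm₀.trans h1)
    · rcases hK₁ (a, b) ⟨⟨ha, hb⟩, hab⟩ with h1 | h1
      · have := hpen2 (a - b)
        simp only at h1
        linarith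
      · have := hpen a ha b hb
        simp only at h1
        linarith
  have hfin := hess_le_of_midpoint (k := c / 4) (v := v) hr0 (h.harmonicAt z hz).1
    (by simpa using hv) (by
      have h1 : ∀ w : EuclideanSpace ℝ (Fin n), ∀ᶠ t : ℝ in 𝓝 0, z + t • w ∈ Ω₀ := fun w => by
        have : Continuous fun t : ℝ => z + t • w := by fun_prop
        refine this.continuousAt.eventually_mem (h.isOpen_outer.mem_nhds ?_)
        simpa using hz.1
      filter_upwards [h1 v, h1 (-v)] with t h1 h2
      have e : (1 / 2 : ℝ) • (z + t • v + (z + t • (-v))) = z := by module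
      have := key _ (subset_closure h1) _ (subset_closure h2)
        (by rw [e]; exact fun hi => hz.2 (subset_closure hi))
      rwa [e, show z + t • v - (z + t • (-v)) = (2 * t) • v by module] at this)
  linarith

end IsRingPotential

/-! ### The boundary minimum -/

/-- For continuous nonnegative `g`, the product `g κ₁` is lower semicontinuous along a compact `C²`
boundary and so attains its minimum. -/
theorem HasC2Boundary.exists_forall_mul_le (h : HasC2Boundary D) (hn : 2 ≤ n) (hD : IsOpen D)
    (hbdd : Bornology.IsBounded D) (hne : D.Nonempty) {g : EuclideanSpace ℝ (Fin n) → ℝ}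
    (hg : ContinuousOn g (frontier D)) (hg0 : ∀ q, 0 ≤ g q) :
    ∃ p ∈ frontier D, ∀ q ∈ frontier D,
      g p * smallestPrincipalCurvature D p ≤ g q * smallestPrincipalCurvature D q := by
  have hcomp : IsCompact (frontier D) :=
    hbdd.isCompact_closure.of_isClosed_subset isClosed_frontier frontier_subset_closure
  have hfne : (frontier D).Nonempty := by
    have : Nontrivial (EuclideanSpace ℝ (Fin n)) :=
      Module.nontrivial_of_finrank_pos (R := ℝ) (by simp; omega)
    rw [nonempty_frontier_iff]
    refine ⟨hne, fun hu => ?_⟩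
    rw [hu] at hbdd
    exact NormedSpace.unbounded_univ ℝ (EuclideanSpace ℝ (Fin n)) hbdd
  suffices hlsc : LowerSemicontinuousOn (fun q => g q * smallestPrincipalCurvature D q)
      (frontier D) by
    obtain ⟨p, hp, hmin⟩ := hlsc.exists_isMinOn hfne hcomp
    exact ⟨p, hp, fun q hq => hmin hq⟩
  intro p hp a ha
  obtain ⟨ρ, hρ⟩ := h p hp
  have htube : ∀ᶠ q in 𝓝 p, ∀ v ∈ Metric.sphere (0 : EuclideanSpace ℝ (Fin n)) 1,
      q ∈ frontier D → inner ℝ (gradient ρ q) v = 0 → a * ‖gradient ρ q‖ < g q * hess ρ q v v := by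
    refine (isCompact_sphere _ 1).eventually_forall_of_forall_eventually fun v hv => ?_
    have hv1 : ‖v‖ = 1 := by simpa using hv
    obtain ⟨A, hA, -⟩ := hasFDerivAt_gradient hρ.contDiffAt
    have hcg : ContinuousAt (fun z : EuclideanSpace ℝ (Fin n) × EuclideanSpace ℝ (Fin n) =>
        gradient ρ z.1) (p, v) :=
      ContinuousAt.comp (g := gradient ρ) (f := Prod.fst) (x := (p, v)) hA.continuousAt
        continuousAt_fst
    have hch : ContinuousAt (fun z : EuclideanSpace ℝ (Fin n) × EuclideanSpace ℝ (Fin n) =>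
        hess ρ z.1 z.2 z.2) (p, v) := by
      have h1 : ContinuousAt (fun q : EuclideanSpace ℝ (Fin n) × EuclideanSpace ℝ (Fin n) =>
          hess ρ q.1) (p, v) :=
        ContinuousAt.comp (f := Prod.fst) hρ.contDiffAt.continuousAt_hess continuousAt_fst
      exact (h1.clm_apply continuousAt_snd).clm_apply continuousAt_snd
    by_cases hvt : inner ℝ (gradient ρ p) v = 0
    · have hpos : a * ‖gradient ρ p‖ < g p * hess ρ p v v := by
        have h1 := (hρ.smallestPrincipalCurvature_spec hn).2 v hvt
        rw [hv1, one_pow, mul_one] at h1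
        have h2 := mul_le_mul_of_nonneg_left h1 (hg0 p)
        have h3 := mul_lt_mul_of_pos_right ha (norm_pos_iff.2 hρ.gradient_ne_zero)
        linarith
      have hcgp : ContinuousWithinAt (fun z : EuclideanSpace ℝ (Fin n) ×
          EuclideanSpace ℝ (Fin n) => g z.1) (Prod.fst ⁻¹' frontier D) (p, v) :=
        ContinuousWithinAt.comp (t := frontier D) (hg p hp) continuousWithinAt_fst
          fun z hz => hz
      have hlt : ∀ᶠ z in 𝓝[Prod.fst ⁻¹' frontier D] (p, v),
          a * ‖gradient ρ z.1‖ < g z.1 * hess ρ z.1 z.2 z.2 :=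
        ((continuousAt_const.mul hcg.norm).continuousWithinAt.tendsto).eventually_lt
          (hcgp.mul hch.continuousWithinAt).tendsto hpos
      filter_upwards [eventually_nhdsWithin_iff.1 hlt] with z hz hzf _
      exact hz hzf
    · filter_upwards [(hcg.inner continuousAt_snd).eventually_ne hvt] with z hz _ hz0
      exact absurd hz0 hz
  have hdef : ∀ᶠ q in 𝓝 p, q ∈ frontier D → IsC2DefiningFunction ρ D q := by
    obtain ⟨A, hA, -⟩ := hasFDerivAt_gradient hρ.contDiffAt
    filter_upwards [hρ.contDiffAt.eventually (by simp), hρ.eventually_frontier hD,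
      hA.continuousAt.eventually_ne hρ.gradient_ne_zero, hρ.mem_iff.eventually_nhds]
      with q h1 h2 h3 h4 hq
    exact ⟨h1, h2.2 hq, h3, h4⟩
  filter_upwards [nhdsWithin_le_nhds htube, nhdsWithin_le_nhds hdef, self_mem_nhdsWithin]
    with q hq1 hq2 hq
  have hρq := hq2 hq
  obtain ⟨v, hv1, hv, hvκ⟩ := (hρq.smallestPrincipalCurvature_spec hn).1
  have := hq1 v (by simpa using hv1) hq hv
  rw [hvκ, ← mul_assoc] at this
  exact lt_of_mul_lt_mul_right this (norm_nonneg _)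

end

/-! ### Level sets of the potential -/

section

variable {n : ℕ} {Ω₀ Ω₁ : Set (EuclideanSpace ℝ (Fin n))} {u : EuclideanSpace ℝ (Fin n) → ℝ}

open Classical in
/-- The function equal to `1` on `S` and to `u` elsewhere. -/
noncomputable def extendByOne {X : Type*} (S : Set X) (u : X → ℝ) (x : X) : ℝ :=
  if x ∈ S then 1 else u x

lemma extendByOne_of_mem {X : Type*} {S : Set X} {u : X → ℝ} {x : X} (hx : x ∈ S) :
    extendByOne S u x = 1 := if_pos hx

lemma extendByOne_of_notMem {X : Type*} {S : Set X} {u : X → ℝ} {x : X} (hx : x ∉ S) :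
    extendByOne S u x = u x := if_neg hx

lemma gradient_eq_zero_of_isLocalExtr {E : Type*} [NormedAddCommGroup E] [InnerProductSpace ℝ E]
    [CompleteSpace E] {f : E → ℝ} {x : E} (h : IsLocalExtr f x) : gradient f x = 0 := by
  refine ext_inner_right ℝ fun v => ?_
  rw [inner_gradient_left, h.fderiv_eq_zero]
  simp

/-- A function without critical points on a bounded open set lies strictly between its boundary
bounds. -/
lemma mem_Ioo_of_gradient_ne_zero {E : Type*} [NormedAddCommGroup E] [InnerProductSpace ℝ E]
    [FiniteDimensional ℝ E] {Ω : Set E} (hΩ : IsOpen Ω) (hbdd : Bornology.IsBounded Ω) {u : E → ℝ}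
    (huc : ContinuousOn u (closure Ω)) (hgrad : ∀ x ∈ Ω, gradient u x ≠ 0) {a b : ℝ}
    (hfr : ∀ x ∈ frontier Ω, u x ∈ Icc a b) {x : E} (hx : x ∈ Ω) : u x ∈ Ioo a b := by
  have hcomp : IsCompact (closure Ω) := hbdd.isCompact_closure
  have hcase : ∀ y ∈ closure Ω, y ∉ Ω → u y ∈ Icc a b := fun y hy hyΩ =>
    hfr y ⟨hy, fun hi => hyΩ (interior_subset hi)⟩
  constructor
  · by_contra hle
    push Not at hle
    obtain ⟨y, hy, hmin⟩ := hcomp.exists_isMinOn ⟨x, subset_closure hx⟩ huc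
    have hint : ∀ y ∈ Ω, ¬ IsMinOn u (closure Ω) y := fun y hy hm =>
      hgrad y hy (gradient_eq_zero_of_isLocalExtr
        (.inl (hm.isLocalMin (mem_of_superset (hΩ.mem_nhds hy) subset_closure))))
    have hyb := hcase y hy fun hyΩ => hint y hyΩ hmin
    exact hint x hx fun w hw => hle.trans (hyb.1.trans (hmin hw))
  · by_contra hle
    push Not at hle
    obtain ⟨y, hy, hmax⟩ := hcomp.exists_isMaxOn ⟨x, subset_closure hx⟩ huc
    have hint : ∀ y ∈ Ω, ¬ IsMaxOn u (closure Ω) y := fun y hy hm =>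
      hgrad y hy (gradient_eq_zero_of_isLocalExtr
        (.inr (hm.isLocalMax (mem_of_superset (hΩ.mem_nhds hy) subset_closure))))
    have hyb := hcase y hy fun hyΩ => hint y hyΩ hmax
    exact hint x hx fun w hw => (hmax hw).trans (hyb.2.trans hle)

/-- The function `u`, continued by `1` over the hole, is a ring potential. -/
theorem isRingPotential_extendByOne (hΩ₀_open : IsOpen Ω₀) (hΩ₀_bdd : Bornology.IsBounded Ω₀)
    (hΩ₁_open : IsOpen Ω₁) (hsub : closure Ω₁ ⊆ Ω₀)
    (huc : ContinuousOn u (closure (ringDomain Ω₀ Ω₁)))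
    (hu_harm : InnerProductSpace.HarmonicOnNhd u (ringDomain Ω₀ Ω₁))
    (hu_zero : ∀ x ∈ frontier Ω₀, u x = 0) (hu_one : ∀ x ∈ frontier Ω₁, u x = 1)
    (hgrad : ∀ x ∈ ringDomain Ω₀ Ω₁, gradient u x ≠ 0)
    (hΩ₀_C2 : HasC2Boundary Ω₀) (hΩ₁_C2 : HasC2Boundary Ω₁)
    (hΩ₀_conv : StrictConvex ℝ (closure Ω₀)) (hΩ₁_conv : StrictConvex ℝ (closure Ω₁)) :
    IsRingPotential Ω₀ Ω₁ (extendByOne (closure Ω₁) u) := by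
  have hopen : IsOpen (ringDomain Ω₀ Ω₁) := hΩ₀_open.sdiff isClosed_closure
  have hfr : ∀ x ∈ frontier (ringDomain Ω₀ Ω₁), u x ∈ Icc (0 : ℝ) 1 := by
    intro x hx
    have hx0 : x ∈ closure Ω₀ := closure_mono sdiff_subset hx.1
    have hxr : x ∉ Ω₀ \ closure Ω₁ := fun h => hx.2 (by rwa [hopen.interior_eq])
    by_cases hxΩ : x ∈ Ω₀
    · have hx1 : x ∈ closure Ω₁ := by
        by_contra h1; exact hxr ⟨hxΩ, h1⟩
      have hx2 : x ∉ Ω₁ := fun h1 => by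
        obtain ⟨y, hy, hy1⟩ := ((mem_closure_iff_frequently.1 hx.1).and_eventually
          (hΩ₁_open.mem_nhds h1)).exists
        exact hy.2 (subset_closure hy1)
      rw [hu_one x ⟨hx1, fun hi => hx2 (by rwa [hΩ₁_open.interior_eq] at hi)⟩]
      simp
    · rw [hu_zero x ⟨hx0, fun hi => hxΩ (by rwa [hΩ₀_open.interior_eq] at hi)⟩]
      simp
  have hIoo : ∀ x ∈ ringDomain Ω₀ Ω₁, u x ∈ Ioo (0 : ℝ) 1 := fun x hx =>
    mem_Ioo_of_gradient_ne_zero hopen (hΩ₀_bdd.subset sdiff_subset) huc hgrad hfr hx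
  have heq : ∀ x ∈ ringDomain Ω₀ Ω₁, extendByOne (closure Ω₁) u =ᶠ[𝓝 x] u := fun x hx => by
    filter_upwards [hopen.mem_nhds hx] with y hy
    exact extendByOne_of_notMem hy.2
  refine ⟨hΩ₀_open, hΩ₁_open, hΩ₀_bdd, hsub, hΩ₀_conv, hΩ₁_conv,
    hΩ₀_C2.interior_closure hΩ₀_open, hΩ₁_C2.interior_closure hΩ₁_open, ?_,
    fun x hx => ?_, fun x hx => extendByOne_of_mem hx, fun x hx => ?_, fun x hx => ?_,
    fun x hx => ?_, fun x hx => ?_⟩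
  · have h1 : ContinuousOn (extendByOne (closure Ω₁) u) (closure Ω₁) :=
      continuousOn_const.congr fun x hx => extendByOne_of_mem hx
    have h2 : ContinuousOn (extendByOne (closure Ω₁) u) (closure (ringDomain Ω₀ Ω₁)) := by
      refine huc.congr fun x hx => ?_
      by_cases hx1 : x ∈ closure Ω₁
      · have hx2 : x ∉ interior Ω₁ := fun hi => by
          obtain ⟨y, hy, hy1⟩ := ((mem_closure_iff_frequently.1 hx).and_eventually
            (mem_interior_iff_mem_nhds.1 hi)).exists
          exact hy.2 (subset_closure hy1)
        rw [extendByOne_of_mem hx1, hu_one x ⟨hx1, hx2⟩]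
      · exact extendByOne_of_notMem hx1
    refine (h1.union_of_isClosed h2 isClosed_closure isClosed_closure).mono fun x hx => ?_
    by_cases hx1 : x ∈ closure Ω₁
    · exact .inl hx1
    · right
      rw [mem_closure_iff_frequently] at hx ⊢
      exact (hx.and_eventually (isClosed_closure.isOpen_compl.mem_nhds hx1)).mono
        fun y hy => ⟨hy.1, hy.2⟩
  · rw [extendByOne_of_notMem, hu_zero x hx]
    exact fun h1 => hx.2 (by rw [hΩ₀_open.interior_eq]; exact hsub h1)
  · rw [extendByOne_of_notMem hx.2]; exact (hIoo x hx).1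
  · rw [extendByOne_of_notMem hx.2]; exact (hIoo x hx).2
  · exact (InnerProductSpace.harmonicAt_congr_nhds (heq x hx)).2 (hu_harm x hx)
  · rw [(heq x hx).gradient_eq]; exact hgrad x hx

lemma enclosedRegion_zero (h : IsRingPotential Ω₀ Ω₁ (extendByOne (closure Ω₁) u))
    (hu_zero : ∀ x ∈ frontier Ω₀, u x = 0) (hu_one : ∀ x ∈ frontier Ω₁, u x = 1) :
    enclosedRegion Ω₀ Ω₁ u 0 = Ω₀ := by
  ext x
  constructor
  · rintro (hx | ⟨hx, hux⟩)
    · exact h.closure_inner_subset (subset_closure hx)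
    · rcases h.mem_cases hx with hx | hx | hx
      · exact hx.1
      · exact absurd (hu_zero x hx) hux.ne'
      · exact h.closure_inner_subset hx.1
  · intro hx
    by_cases hx1 : x ∈ Ω₁
    · exact .inl hx1
    · refine .inr ⟨h.mem_closure_ring (subset_closure hx) hx1, ?_⟩
      by_cases hxc : x ∈ closure Ω₁
      · rw [hu_one x ⟨hxc, fun hi => hx1 (interior_subset hi)⟩]; exact zero_lt_one
      · have := h.pos x ⟨hx, hxc⟩
        rwa [extendByOne_of_notMem hxc] at this

lemma enclosedRegion_one (h : IsRingPotential Ω₀ Ω₁ (extendByOne (closure Ω₁) u))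
    (hu_zero : ∀ x ∈ frontier Ω₀, u x = 0) (hu_one : ∀ x ∈ frontier Ω₁, u x = 1) :
    enclosedRegion Ω₀ Ω₁ u 1 = Ω₁ := by
  refine subset_antisymm ?_ subset_union_left
  rintro x (hx | ⟨hx, hux⟩)
  · exact hx
  · rcases h.mem_cases hx with hx | hx | hx
    · have := h.lt_one x hx
      rw [extendByOne_of_notMem hx.2] at this
      linarith
    · rw [hu_zero x hx] at hux; linarith
    · rw [hu_one x hx] at hux; exact absurd hux (lt_irrefl _)

/-- In the ring, `u x - u` defines the region enclosed by the level set through `x`. -/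
lemma isC2DefiningFunction_level {x : EuclideanSpace ℝ (Fin n)} (hΩ₀ : IsOpen Ω₀)
    (hx : x ∈ ringDomain Ω₀ Ω₁) (hu : ContDiffAt ℝ 2 u x) (hgrad : gradient u x ≠ 0) :
    IsC2DefiningFunction (fun y => u x - u y) (enclosedRegion Ω₀ Ω₁ u (u x)) x where
  contDiffAt := contDiffAt_const.sub hu
  eq_zero := sub_self _
  gradient_ne_zero := by
    intro h0
    refine hgrad (ext_inner_right ℝ fun v => ?_)
    have := congrArg (fun w => inner ℝ w v) h0
    simpa [fderiv_const_sub] using this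
  mem_iff := by
    have hopen : IsOpen (ringDomain Ω₀ Ω₁) := hΩ₀.sdiff isClosed_closure
    filter_upwards [hopen.mem_nhds hx] with y hy
    rw [sub_neg]
    constructor
    · rintro (hy1 | hy1)
      · exact absurd (subset_closure hy1) hy.2
      · exact hy1.2
    · exact fun h => .inr ⟨subset_closure hy, h⟩

/-- In the ring, `|Du| κ₁` is the value of `-D²u` at some unit vector tangent to the level set. -/
lemma exists_norm_gradient_mul_kappaOne_eq {x : EuclideanSpace ℝ (Fin n)} (hn : 2 ≤ n)
    (hΩ₀ : IsOpen Ω₀) (hx : x ∈ ringDomain Ω₀ Ω₁) (hu : ContDiffAt ℝ 2 u x)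
    (hgrad : gradient u x ≠ 0) :
    ∃ v, ‖v‖ = 1 ∧ inner ℝ (gradient u x) v = 0 ∧
      ‖gradient u x‖ * kappaOne Ω₀ Ω₁ u x = -hess u x v v := by
  have hρ := isC2DefiningFunction_level hΩ₀ hx hu hgrad
  obtain ⟨v, hv1, hv, hvκ⟩ := (hρ.smallestPrincipalCurvature_spec hn).1
  have hfd : fderiv ℝ (fun y => u x - u y) = fun y => -fderiv ℝ u y := by
    funext y; exact fderiv_const_sub _
  have hg : gradient (fun y => u x - u y) x = -gradient u x := by
    refine ext_inner_right ℝ fun w => ?_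
    rw [inner_neg_left, inner_gradient_left, inner_gradient_left, hfd]
    rfl
  have hh : hess (fun y => u x - u y) x v v = -hess u x v v := by
    rw [hess, hfd, show (fun y => -fderiv ℝ u y) = -fderiv ℝ u from rfl, fderiv_neg]
    rfl
  rw [hg, inner_neg_left, neg_eq_zero] at hv
  rw [hh, hg, norm_neg] at hvκ
  exact ⟨v, hv1, hv, by rw [hvκ, mul_comm]; rfl⟩

end

theorem theorem1p2 {n : ℕ} (hn : 2 ≤ n)
    (Ω₀ Ω₁ : Set (EuclideanSpace ℝ (Fin n)))
    (hΩ₀_open : IsOpen Ω₀) (hΩ₀_conn : IsConnected Ω₀) (hΩ₀_bdd : Bornology.IsBounded Ω₀)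
    (hΩ₁_open : IsOpen Ω₁) (hΩ₁_conn : IsConnected Ω₁) (hΩ₁_bdd : Bornology.IsBounded Ω₁)
    (hsub : closure Ω₁ ⊆ Ω₀)
    (u : EuclideanSpace ℝ (Fin n) → ℝ)
    (hu_C1 : IsC1UpToBoundary u (ringDomain Ω₀ Ω₁))
    (hu_harm : InnerProductSpace.HarmonicOnNhd u (ringDomain Ω₀ Ω₁))
    (hu_zero : ∀ x ∈ frontier Ω₀, u x = 0)
    (hu_one : ∀ x ∈ frontier Ω₁, u x = 1)
    (hgrad : ∀ x ∈ ringDomain Ω₀ Ω₁, gradient u x ≠ 0)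
    (hΩ₀_C2 : HasC2Boundary Ω₀) (hΩ₁_C2 : HasC2Boundary Ω₁)
    (hΩ₀_conv : StrictConvex ℝ (closure Ω₀)) (hΩ₁_conv : StrictConvex ℝ (closure Ω₁)) :
    ∃ p ∈ frontier (ringDomain Ω₀ Ω₁),
      IsMinOn (fun x => ‖closedGradient u (ringDomain Ω₀ Ω₁) x‖ * kappaOne Ω₀ Ω₁ u x)
        (closure (ringDomain Ω₀ Ω₁)) p := by
  have h := isRingPotential_extendByOne hΩ₀_open hΩ₀_bdd hΩ₁_open hsub hu_C1.continuousOn hu_harm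
    hu_zero hu_one hgrad hΩ₀_C2 hΩ₁_C2 hΩ₀_conv hΩ₁_conv
  set U := extendByOne (closure Ω₁) u with hU
  set G := closedGradient u (ringDomain Ω₀ Ω₁) with hG
  have hring : ringDomain Ω₀ Ω₁ = Ω₀ \ closure Ω₁ := rfl
  have hopen : IsOpen (ringDomain Ω₀ Ω₁) := h.isOpen_ring
  -- the closed gradient is the continuous extension of the gradient
  obtain ⟨G', hG'c, hG'u⟩ := hu_C1.exists_extension
  have hlim : ∀ x ∈ closure (ringDomain Ω₀ Ω₁),
      Tendsto (gradient u) (𝓝[ringDomain Ω₀ Ω₁] x) (𝓝 (G' x)) := fun x hx =>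
    ((hG'c x hx).mono subset_closure).tendsto.congr'
      (eventually_nhdsWithin_of_forall fun y hy => hG'u hy)
  have hGc : ContinuousOn G (closure (ringDomain Ω₀ Ω₁)) :=
    continuousOn_extendFrom subset_rfl fun x hx => ⟨_, hlim x hx⟩
  have hGu : ∀ x ∈ ringDomain Ω₀ Ω₁, G x = gradient u x := fun x hx => by
    rw [hG, closedGradient, extendFrom_eq (subset_closure hx) (hlim x (subset_closure hx)),
      hG'u hx]
  have heq : ∀ x ∈ ringDomain Ω₀ Ω₁, U =ᶠ[𝓝 x] u := fun x hx => by
    filter_upwards [hopen.mem_nhds hx] with y hy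
    exact extendByOne_of_notMem hy.2
  have hhess : ∀ x ∈ ringDomain Ω₀ Ω₁, hess U x = hess u x := fun x hx =>
    (heq x hx).fderiv.fderiv_eq
  have hgU : ∀ x ∈ ringDomain Ω₀ Ω₁, gradient U x = gradient u x := fun x hx =>
    (heq x hx).gradient_eq
  have hfrontier : frontier (ringDomain Ω₀ Ω₁) = frontier Ω₀ ∪ frontier Ω₁ := h.frontier_ring
  have hκ₀ : ∀ x ∈ frontier Ω₀, kappaOne Ω₀ Ω₁ u x = smallestPrincipalCurvature Ω₀ x :=
    fun x hx => by rw [kappaOne, hu_zero x hx, enclosedRegion_zero h hu_zero hu_one]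
  have hκ₁ : ∀ x ∈ frontier Ω₁, kappaOne Ω₀ Ω₁ u x = smallestPrincipalCurvature Ω₁ x :=
    fun x hx => by rw [kappaOne, hu_one x hx, enclosedRegion_one h hu_zero hu_one]
  obtain ⟨p₀, hp₀, hmin₀⟩ := hΩ₀_C2.exists_forall_mul_le hn hΩ₀_open hΩ₀_bdd hΩ₀_conn.nonempty
    (g := fun x => ‖G x‖) (hGc.norm.mono fun x hx => (h.frontier_outer_subset hx).1)
    fun q => norm_nonneg _
  obtain ⟨p₁, hp₁, hmin₁⟩ := hΩ₁_C2.exists_forall_mul_le hn hΩ₁_open hΩ₁_bdd hΩ₁_conn.nonempty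
    (g := fun x => ‖G x‖) (hGc.norm.mono fun x hx => h.frontier_inner_subset hx)
    fun q => norm_nonneg _
  obtain ⟨p, hp, hp₀', hp₁'⟩ : ∃ p ∈ frontier (ringDomain Ω₀ Ω₁),
      (∀ q ∈ frontier Ω₀, ‖G p‖ * kappaOne Ω₀ Ω₁ u p ≤ ‖G q‖ * smallestPrincipalCurvature Ω₀ q) ∧
      ∀ q ∈ frontier Ω₁, ‖G p‖ * kappaOne Ω₀ Ω₁ u p ≤ ‖G q‖ * smallestPrincipalCurvature Ω₁ q := by
    rw [hfrontier]
    rcases le_total (‖G p₀‖ * smallestPrincipalCurvature Ω₀ p₀)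
      (‖G p₁‖ * smallestPrincipalCurvature Ω₁ p₁) with hle | hle
    · refine ⟨p₀, .inl hp₀, ?_, ?_⟩ <;> rw [hκ₀ p₀ hp₀]
      · exact hmin₀
      · exact fun q hq => hle.trans (hmin₁ q hq)
    · refine ⟨p₁, .inr hp₁, ?_, ?_⟩ <;> rw [hκ₁ p₁ hp₁]
      · exact fun q hq => hle.trans (hmin₀ q hq)
      · exact hmin₁
  refine ⟨p, hp, fun x hx => ?_⟩
  change ‖G p‖ * kappaOne Ω₀ Ω₁ u p ≤ ‖G x‖ * kappaOne Ω₀ Ω₁ u x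
  rcases h.mem_cases hx with hxr | hx0 | hx1
  · obtain ⟨v, hv1, hv, hvκ⟩ := exists_norm_gradient_mul_kappaOne_eq hn hΩ₀_open hxr
      (hu_harm x hxr).1 (hgrad x hxr)
    rw [hGu x hxr, hvκ, ← hhess x hxr]
    rw [← hgU x hxr] at hv
    refine le_of_forall_lt_imp_le_of_dense fun c hc => ?_
    rcases le_or_gt c 0 with hc0 | hc0
    · have := h.hess_nonpos (by simp; omega) hxr hv
      linarith
    · have := h.hess_le hn hΩ₀_C2 hΩ₁_C2 hGc (fun y hy => (hGu y hy).trans (hgU y hy).symm) hc0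
        (fun q hq => hc.trans_le (hp₀' q hq)) (fun q hq => hc.trans_le (hp₁' q hq)) hxr hv
      rw [hv1] at this
      linarith
  · rw [hκ₀ x hx0]; exact hp₀' x hx0
  · rw [hκ₁ x hx1]; exact hp₁' x hx1
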